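/- Let $k\ge 1$ be an integer. A $k$-graph is a finite hypergraph all of whose edges have exactly $k$ vertices. A copy of a $k$-graph $F$ in a $k$-graph $G$ is a (not necessarily induced) subhypergraph of $G$ isomorphic to $F$, and $v(F)$ denotes the number of vertices of $F$. The $F$-removal lemma is called *polynomial* if there are $c>0$ and $C\in\mathbb{N}$ such that, for every $\varepsilon\in(0,1)$ and every $n$, every $n$-vertex $k$-graph $G$ that contains at least $\varepsilon n^k$ pairwise edge-disjoint copies of $F$ contains at least $c\,\varepsilon^{C} n^{v(F)}$ copies of $F$. A $k$-graph is $k$-partite if its vertices can be partitioned into $k$ (possibly empty) parts such that every edge contains exactly one vertex of each part. **Theorem 1.** For every $k$-graph $F$ with at least one vertex, the $F$-removal lemma is polynomial if and only if $F$ is $k$-partite. The same equivalence holds when, in the definition of polynomial, the bound is only required for all $n\ge n_0$, where $n_0$ may depend on $\varepsilon$ (and on $F$). -/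

import Mathlib

open scoped Hypergraph

namespace Hypergraph

/-- Every edge has exactly `k` vertices. -/
def IsUniform {α : Type*} (H : Hypergraph α) (k : ℕ) : Prop :=
  ∀ e ∈ E(H), e.ncard = k

/-- The vertices can be partitioned into `k` (possibly empty) parts such that every edge contains
exactly one vertex of each part. -/
def IsPartite {α : Type*} (H : Hypergraph α) (k : ℕ) : Prop :=
  ∃ χ : α → Fin k, ∀ e ∈ E(H), Set.BijOn χ e Set.univ

/-- `H` is a (not necessarily induced) subhypergraph of `G`. -/
def IsSubhypergraph {α : Type*} (H G : Hypergraph α) : Prop :=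
  V(H) ⊆ V(G) ∧ E(H) ⊆ E(G)

/-- The copies of `F` in `G`: the subhypergraphs of `G` that are isomorphic to `F`. -/
def copies {W α : Type*} (F : Hypergraph W) (G : Hypergraph α) : Set (Hypergraph α) :=
  {H | H.IsSubhypergraph G ∧ ∃ f : W → α, Set.InjOn f V(F) ∧ H = F.image f}

/-- A finite hypergraph has only finitely many copies of `F`, so that `(copies F G).ncard` is
their number. -/
theorem copies_finite {W α : Type*} (F : Hypergraph W) (G : Hypergraph α) (hG : V(G).Finite) :
    (copies F G).Finite := by
  have hE : E(G).Finite :=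
    hG.finite_subsets.subset fun _ he => G.subset_vertexSet_of_mem_edgeSet' he
  refine Set.Finite.of_finite_image (f := fun H => (V(H), E(H)))
    ((hG.finite_subsets.prod hE.finite_subsets).subset ?_) ?_
  · rintro _ ⟨H, hH, rfl⟩
    exact ⟨hH.1.1, hH.1.2⟩
  · intro H _ H' _ h
    exact Hypergraph.ext (Prod.mk.inj h).1 (Prod.mk.inj h).2

/-- `G` contains at least `m` pairwise edge-disjoint copies of `F`. -/
def HasEdgeDisjointCopies {W α : Type*} (F : Hypergraph W) (G : Hypergraph α) (m : ℝ) : Prop :=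
  ∃ 𝒞 : Finset (Hypergraph α), (∀ H ∈ 𝒞, H ∈ copies F G) ∧
    (∀ H₁ ∈ 𝒞, ∀ H₂ ∈ 𝒞, H₁ ≠ H₂ → Disjoint E(H₁) E(H₂)) ∧ m ≤ (𝒞.card : ℝ)

/-- Every `n`-vertex `k`-uniform hypergraph with at least `ε * n ^ k` pairwise edge-disjoint copies
of `F` contains at least `δ * n ^ v(F)` copies of `F`. -/
def RemovalHolds {W : Type*} (k : ℕ) (F : Hypergraph W) (ε δ : ℝ) (n : ℕ) : Prop :=
  ∀ (α : Type) (G : Hypergraph α), V(G).Finite → V(G).ncard = n → G.IsUniform k →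
    HasEdgeDisjointCopies F G (ε * (n : ℝ) ^ k) →
      δ * (n : ℝ) ^ V(F).ncard ≤ ((copies F G).ncard : ℝ)

/-- The `F`-removal lemma for `k`-uniform hypergraphs is polynomial: it holds, on all numbers of
vertices, with a `δ` that is bounded below by a polynomial in `ε`. -/
def PolynomialRemoval {W : Type*} (k : ℕ) (F : Hypergraph W) : Prop :=
  ∃ c : ℝ, 0 < c ∧ ∃ C : ℕ, ∀ ε : ℝ, 0 < ε → ε < 1 →
    ∀ n : ℕ, RemovalHolds k F ε (c * ε ^ C) n

/-- The `F`-removal lemma is polynomial for hypergraphs with sufficiently many vertices in terms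
of `ε`. -/
def EventuallyPolynomialRemoval {W : Type*} (k : ℕ) (F : Hypergraph W) : Prop :=
  ∃ c : ℝ, 0 < c ∧ ∃ C : ℕ, ∀ ε : ℝ, 0 < ε → ε < 1 →
    ∃ N : ℕ, ∀ n : ℕ, N ≤ n → RemovalHolds k F ε (c * ε ^ C) n

end Hypergraph

/-!
A `k`-partite `F` has a polynomial removal lemma by supersaturation. Edge-disjoint copies of `F` make
`G` dense, a Jensen argument (`mean_pow_le_mean_prod`) turns density `ε` into at least
`ε ^ (v ^ k) * n ^ v` homomorphisms from `F` (`le_card_homs`), and all but `v ^ 2 * n ^ (v - 1)` of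
these maps are injective. If `n` is too small for this to help, a single copy of `F` already meets
the bound.

Suppose now that `F` is not `k`-partite. Its core, the hypergraph induced on a minimal image of an
endomorphism `r`, is not `k`-partite either. If the 2-shadow of the core were chordal and each of its
cliques lay in an edge, then the 2-shadow would be `k`-colourable, since chordal graphs are perfect
(`exists_coloring_of_no_hole`). So it has an induced cycle of length at least `4`, or there is a
simplex: a set of at least three vertices in no edge, all of whose proper subsets lie in edges
(`exists_isHole_or_simplex`).

Either structure supports a construction in the style of Ruzsa and Szemerédi. Let `H` be a vector
space over `ℤ/p`. The vertices of the core get coefficient vectors `c w` such that parameters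
`q ∈ H ^ k` place `w` at `∑ j, c w j • q j`. The vectors on each edge are independent, so that copies
placed for different `q` are edge-disjoint. A further vector `θ` selects those `q` for which
`∑ j, θ j • q j` lies in a set `A` in which no element is a nontrivial average of others. Along the
cycle, or around the simplex, arbitrary positions that agree on each edge with some selected `q`
produce such an average in `A`, hence satisfy a nontrivial linear relation (`exists_isObstruction`).

The union `G` of the placed copies therefore has few copies of `F`. The part labels of a copy of `F`
in `G` induce an endomorphism of `F` into its core, which permutes the vertices of the core, so that
the relation removes a factor `|H|` from the number of copies (`ncard_copies_placedUnion_mul_le`).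
With `H = (ℤ/p) ^ D` and `A` the image of the lattice points on a sphere, `ε` is of order `p ^ (-2)`,
while the density of copies is at most `p ^ (-D)`. A further factor `(ℤ/p) ^ N` blows the construction
up to arbitrarily many vertices for the same `ε`. Taking `D > 2 * C` and `p` large contradicts
a bound `c * ε ^ C` (`not_eventuallyPolynomialRemoval`).
-/

namespace Hypergraph

/-! ### Chordal graphs -/

/-- The vertices `h 0, …, h (ℓ - 1)` form, in this cyclic order, an induced cycle of length
`ℓ ≥ 4` of `G`. The values of `h` at other arguments are irrelevant. -/
structure IsHole {W : Type*} (G : SimpleGraph W) (ℓ : ℕ) (h : ℕ → W) : Prop where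
  four_le : 4 ≤ ℓ
  ne : ∀ i j, i < j → j < ℓ → h i ≠ h j
  adj_iff : ∀ i j, i < j → j < ℓ → (G.Adj (h i) (h j) ↔ j = i + 1 ∨ i = 0 ∧ j + 1 = ℓ)

/-- The sequence `p 0, …, p m` is a walk from `x` to `y` in `G` with all inner vertices in `B`. -/
structure IsWalkThrough {W : Type*} (G : SimpleGraph W) (B : Set W) (x y : W) (m : ℕ)
    (p : ℕ → W) : Prop where
  start : p 0 = x
  finish : p m = y
  adj : ∀ i < m, G.Adj (p i) (p (i + 1))
  mem : ∀ i, 0 < i → i < m → p i ∈ B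

/-- A shortest walk through `B` is an induced path. -/
theorem IsWalkThrough.exists_induced {W : Type*} {G : SimpleGraph W} {B : Set W} {x y : W}
    (hex : ∃ m p, IsWalkThrough G B x y m p) :
    ∃ m p, IsWalkThrough G B x y m p ∧
      ∀ i j, i < j → j ≤ m → p i ≠ p j ∧ (G.Adj (p i) (p j) → j = i + 1) := by
  classical
  obtain ⟨p, hp⟩ := Nat.find_spec hex
  have hmin : ∀ m' < Nat.find hex, ∀ q, ¬ IsWalkThrough G B x y m' q :=
    fun m' h q hq => Nat.find_min hex h ⟨q, hq⟩
  refine ⟨Nat.find hex, p, hp, ?_⟩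
  generalize Nat.find hex = m at *
  intro i j hij hjm
  -- Skipping the part of the walk strictly between `i` and `j` would give a shorter walk.
  constructor
  · intro heq
    refine hmin (m - (j - i)) (by omega) (fun t => if t ≤ i then p t else p (t + (j - i)))
      ⟨by simp [hp.start], ?_, ?_, ?_⟩
    · split_ifs with h
      · have h1 : j = m := by omega
        have h2 : m - (j - i) = i := by omega
        rw [h2, heq, h1, hp.finish]
      · rw [show m - (j - i) + (j - i) = m by omega, hp.finish]
    · intro t ht
      rcases lt_trichotomy t i with h | h | h
      · rw [if_pos (by omega), if_pos (by omega)]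
        exact hp.adj t (by omega)
      · subst h
        rw [if_pos le_rfl, if_neg (by omega), heq]
        rw [show t + 1 + (j - t) = j + 1 by omega]
        exact hp.adj j (by omega)
      · rw [if_neg (by omega), if_neg (by omega), show t + 1 + (j - i) = t + (j - i) + 1 by omega]
        exact hp.adj _ (by omega)
    · intro t h0 ht
      split_ifs
      · exact hp.mem _ h0 (by omega)
      · exact hp.mem _ (by omega) (by omega)
  · intro hadj
    by_contra hne
    refine hmin (m - (j - i - 1)) (by omega)
      (fun t => if t ≤ i then p t else p (t + (j - i - 1))) ⟨by simp [hp.start], ?_, ?_, ?_⟩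
    · rw [if_neg (by omega), show m - (j - i - 1) + (j - i - 1) = m by omega, hp.finish]
    · intro t ht
      rcases lt_trichotomy t i with h | h | h
      · rw [if_pos (by omega), if_pos (by omega)]
        exact hp.adj t (by omega)
      · subst h
        rw [if_pos le_rfl, if_neg (by omega), show t + 1 + (j - t - 1) = j by omega]
        exact hadj
      · rw [if_neg (by omega), if_neg (by omega),
          show t + 1 + (j - i - 1) = t + (j - i - 1) + 1 by omega]
        exact hp.adj _ (by omega)
    · intro t h0 ht
      split_ifs
      · exact hp.mem _ h0 (by omega)
      · exact hp.mem _ (by omega) (by omega)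

/-- Two nonadjacent neighbours of `v` that are joined by a walk avoiding the closed neighbourhood
of `v` lie on a hole through `v`. -/
theorem IsWalkThrough.exists_isHole {W : Type*} {G : SimpleGraph W} {B : Set W} {x y v : W}
    (hex : ∃ m p, IsWalkThrough G B x y m p) (hxy : x ≠ y) (hnadj : ¬ G.Adj x y)
    (hvx : G.Adj v x) (hvy : G.Adj v y) (hB : ∀ w ∈ B, w ≠ v ∧ ¬ G.Adj v w) :
    ∃ ℓ h, IsHole G ℓ h := by
  obtain ⟨m, p, hp, hind⟩ := exists_induced hex
  have hm : 2 ≤ m := by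
    by_contra hlt
    interval_cases m
    · exact hxy (hp.start.symm.trans hp.finish)
    · exact hnadj (hp.start ▸ hp.finish ▸ hp.adj 0 one_pos)
  have hv : ∀ j ≤ m, v ≠ p j ∧ (G.Adj v (p j) ↔ j = 0 ∨ j = m) := by
    intro j hj
    rcases Nat.eq_zero_or_pos j with rfl | h0
    · rw [hp.start]; exact ⟨hvx.ne, by simp [hvx]⟩
    · rcases hj.eq_or_lt with rfl | hlt
      · rw [hp.finish]; exact ⟨hvy.ne, by simp [hvy]⟩
      · have := hB _ (hp.mem j h0 hlt)
        exact ⟨this.1.symm, iff_of_false this.2 (by omega)⟩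
  refine ⟨m + 2, fun i => if i = 0 then v else p (i - 1), by omega, ?_, ?_⟩
  · intro i j hij hj
    rcases Nat.eq_zero_or_pos i with rfl | h0
    · simpa [hij.ne'] using (hv (j - 1) (by omega)).1
    · simpa [hij.ne', h0.ne', (h0.trans hij).ne'] using (hind (i - 1) (j - 1) (by omega) (by omega)).1
  · intro i j hij hj
    rcases Nat.eq_zero_or_pos i with rfl | h0
    · have := (hv (j - 1) (by omega)).2
      rw [if_pos rfl, if_neg hij.ne', this]
      omega
    · rw [if_neg h0.ne', if_neg (h0.trans hij).ne']
      constructor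
      · intro hadj
        have := (hind (i - 1) (j - 1) (by omega) (by omega)).2 hadj
        omega
      · intro h
        have hj' : j = i + 1 := by omega
        subst hj'
        have := hp.adj (i - 1) (by omega)
        rwa [show i - 1 + 1 = i + 1 - 1 by omega] at this

/-- A chordal graph without cliques of size `k + 1` is `k`-colourable, here on a finite set `T`
of vertices. If `T` is not a clique, then a component of the complement of a closed neighbourhood
has a clique as its boundary, and colourings of the two sides of it can be glued. -/
theorem exists_coloring_of_no_hole {W : Type*} (G : SimpleGraph W) {k : ℕ} (hk : 1 ≤ k)
    (hhole : ¬ ∃ ℓ h, IsHole G ℓ h) (hclique : G.CliqueFree (k + 1)) (T : Finset W) :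
    ∃ χ : W → Fin k, ∀ u ∈ T, ∀ w ∈ T, G.Adj u w → χ u ≠ χ w := by
  classical
  induction hn : T.card using Nat.strong_induction_on generalizing T with
  | _ n ih =>
  by_cases hT : ∀ v ∈ T, ∀ b ∈ T, v ≠ b → G.Adj v b
  · have hcard : T.card ≤ k := by
      by_contra hlt
      obtain ⟨s, hsT, hs⟩ := Finset.exists_subset_card_eq (show k + 1 ≤ T.card by omega)
      exact hclique s ⟨fun a ha b hb hab => hT a (hsT ha) b (hsT hb) hab, hs⟩
    obtain ⟨f⟩ : Nonempty (T ↪ Fin k) := Function.Embedding.nonempty_of_card_le (by simpa)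
    refine ⟨fun w => if h : w ∈ T then f ⟨w, h⟩ else ⟨0, hk⟩, fun u hu w hw hadj h => hadj.ne ?_⟩
    dsimp only at h
    rw [dif_pos hu, dif_pos hw] at h
    exact congrArg Subtype.val (f.injective h)
  push Not at hT
  obtain ⟨v, hvT, b, hbT, hvb, hnadj⟩ := hT
  let D : Set W := {w | w ∈ T ∧ w ≠ v ∧ ¬ G.Adj v w}
  have hbD : b ∈ D := ⟨hbT, hvb.symm, hnadj⟩
  let G' : SimpleGraph W :=
    { Adj := fun u w => G.Adj u w ∧ u ∈ D ∧ w ∈ D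
      symm := ⟨fun u w h => ⟨h.1.symm, h.2.2, h.2.1⟩⟩
      loopless := ⟨fun u h => h.1.ne rfl⟩ }
  have hreach : ∀ u w, G'.Reachable u w → u ∈ D → w ∈ D := by
    rintro u w ⟨q⟩ hu
    induction q with
    | nil => exact hu
    | cons h _ ih' => exact ih' h.2.2
  let B : Finset W := {w ∈ T | G'.Reachable b w}
  have hBD : ∀ w ∈ B, w ∈ D := fun w hw => hreach b w (Finset.mem_filter.1 hw).2 hbD
  have hbB : b ∈ B := Finset.mem_filter.2 ⟨hbT, .refl b⟩
  let N : Finset W := {x ∈ T \ B | ∃ w ∈ B, G.Adj w x}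
  have hNv : ∀ x ∈ N, G.Adj v x := by
    intro x hx
    obtain ⟨hxT, w, hw, hwx⟩ := Finset.mem_filter.1 hx
    rw [Finset.mem_sdiff] at hxT
    by_contra hvx
    have hxD : x ∈ D := ⟨hxT.1, fun h => (hBD w hw).2.2 (h ▸ hwx.symm), hvx⟩
    exact hxT.2 (Finset.mem_filter.2 ⟨hxT.1, (Finset.mem_filter.1 hw).2.trans
      (SimpleGraph.Adj.reachable (G := G') ⟨hwx, hBD w hw, hxD⟩)⟩)
  have hNclique : ∀ x ∈ N, ∀ y ∈ N, x ≠ y → G.Adj x y := by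
    intro x hx y hy hxy
    by_contra hnxy
    obtain ⟨-, b₁, hb₁, hb₁x⟩ := Finset.mem_filter.1 hx
    obtain ⟨-, b₂, hb₂, hb₂y⟩ := Finset.mem_filter.1 hy
    obtain ⟨q⟩ : G'.Reachable b₁ b₂ :=
      (Finset.mem_filter.1 hb₁).2.symm.trans (Finset.mem_filter.1 hb₂).2
    have hq : ∀ i, q.getVert i ∈ D := fun i => hreach b₁ _ ⟨q.take i⟩ (hBD b₁ hb₁)
    refine hhole (IsWalkThrough.exists_isHole (B := D) (x := x) (y := y) (v := v)
      ⟨q.length + 2, fun t => if t = 0 then x else if t ≤ q.length + 1 then q.getVert (t - 1)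
        else y, by simp, by simp, ?_, ?_⟩ hxy hnxy (hNv x hx) (hNv y hy) fun w hw => hw.2)
    · intro i hi
      rcases Nat.eq_zero_or_pos i with rfl | h0
      · simpa using hb₁x.symm
      · rcases (Nat.lt_succ_iff.1 hi).eq_or_lt with rfl | hlt
        · simpa using hb₂y
        · have := (q.adj_getVert_succ (i := i - 1) (by omega)).1
          rw [Nat.sub_add_cancel h0] at this
          simpa [h0.ne', hlt.le, Nat.lt_succ_iff.1 hlt] using this
    · intro i h0 hi
      simpa [h0.ne', Nat.lt_succ_iff.1 hi] using hq (i - 1)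
  have hBT : B ⊆ T := Finset.filter_subset _ _
  have hNT : ∀ x ∈ N, x ∈ T ∧ x ∉ B := fun x hx => Finset.mem_sdiff.1 (Finset.mem_filter.1 hx).1
  obtain ⟨χ₁, hχ₁⟩ := ih _ (hn ▸ Finset.card_lt_card (Finset.ssubset_iff_subset_ne.2
    ⟨Finset.sdiff_subset, fun h => (Finset.mem_sdiff.1 (h ▸ hbT)).2 hbB⟩)) (T \ B) rfl
  have hsub : B ∪ N ⊆ T := Finset.union_subset hBT fun x hx => (hNT x hx).1
  obtain ⟨χ₂, hχ₂⟩ := ih _ (hn ▸ Finset.card_lt_card (Finset.ssubset_iff_subset_ne.2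
    ⟨hsub, fun h => (Finset.mem_union.1 (h ▸ hvT : v ∈ B ∪ N)).elim
      (fun h' => (hBD v h').2.1 rfl) fun h' => (hNv v h').ne rfl⟩)) (B ∪ N) rfl
  have hinj₁ : Set.InjOn χ₁ N := fun x hx y hy h => by
    by_contra hxy
    exact hχ₁ x (Finset.mem_sdiff.2 (hNT x hx)) y (Finset.mem_sdiff.2 (hNT y hy))
      (hNclique x hx y hy hxy) h
  have hinj₂ : Set.InjOn χ₂ N := fun x hx y hy h => by
    by_contra hxy
    exact hχ₂ x (Finset.mem_union_right _ hx) y (Finset.mem_union_right _ hy)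
      (hNclique x hx y hy hxy) h
  -- Permute the colours on `B ∪ N` so that the two colourings agree on the clique `N`.
  obtain ⟨σ, hσ⟩ : ∃ σ : Fin k → Fin k, σ.Injective ∧ ∀ x ∈ N, σ (χ₂ x) = χ₁ x := by
    have : Nonempty W := ⟨v⟩
    have hleft : ∀ x ∈ N, Function.invFunOn χ₂ N (χ₂ x) = x :=
      fun x hx => hinj₂.leftInvOn_invFunOn hx
    obtain ⟨g, hg⟩ := Finset.exists_equiv_extend_of_card_eq (α := Fin k)
      (t := (Finset.univ : Finset (Fin k))) (by simp) (s := N.image χ₂)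
      (f := fun c => χ₁ (Function.invFunOn χ₂ N c)) (Finset.subset_univ _) (by
        intro c hc c' hc' h
        obtain ⟨x, hx, rfl⟩ := Finset.mem_image.1 hc
        obtain ⟨x', hx', rfl⟩ := Finset.mem_image.1 hc'
        simp only [hleft x hx, hleft x' hx'] at h
        rw [hinj₁ hx hx' h])
    refine ⟨fun c => g c, fun c c' h => g.injective (Subtype.ext h), fun x hx => ?_⟩
    dsimp only
    rw [hg _ (Finset.mem_image_of_mem _ hx), hleft x hx]
  have hcross : ∀ u ∈ B, ∀ w ∈ T, w ∉ B → G.Adj u w → σ (χ₂ u) ≠ χ₁ w := by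
    intro u hu w hw hwB hadj h
    have hwN : w ∈ N := Finset.mem_filter.2 ⟨Finset.mem_sdiff.2 ⟨hw, hwB⟩, u, hu, hadj⟩
    rw [← hσ.2 w hwN] at h
    exact hχ₂ u (Finset.mem_union_left _ hu) w (Finset.mem_union_right _ hwN) hadj (hσ.1 h)
  refine ⟨fun w => if w ∈ B then σ (χ₂ w) else χ₁ w, fun u hu w hw hadj => ?_⟩
  dsimp only
  split_ifs with h₁ h₂ h₂
  · exact fun h => hχ₂ u (Finset.mem_union_left _ h₁) w (Finset.mem_union_left _ h₂) hadj (hσ.1 h)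
  · exact hcross u h₁ w hw h₂ hadj
  · exact (hcross w h₂ u hu h₁ hadj.symm).symm
  · exact hχ₁ u (Finset.mem_sdiff.2 ⟨hu, h₁⟩) w (Finset.mem_sdiff.2 ⟨hw, h₂⟩) hadj

/-! ### Obstructions to being `k`-partite -/

/-- The 2-shadow of a set system: two vertices are adjacent if they lie in a common edge. -/
def shadow {W : Type*} (𝓔 : Set (Set W)) : SimpleGraph W where
  Adj u w := u ≠ w ∧ ∃ e ∈ 𝓔, u ∈ e ∧ w ∈ e
  symm := ⟨fun _ _ h => ⟨h.1.symm, h.2.imp fun _ h' => ⟨h'.1, h'.2.2, h'.2.1⟩⟩⟩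
  loopless := ⟨fun _ h => h.1 rfl⟩

/-- A `k`-uniform system that is not `k`-partite has a hole in its 2-shadow, or a simplex: a set
of at least three vertices that lies in no edge although all its proper subsets do. Otherwise the
2-shadow is chordal and its cliques lie in edges, so that it is `k`-colourable. -/
theorem exists_isHole_or_simplex {W : Type*} {𝓔 : Set (Set W)} {U : Set W} {k : ℕ} (hk : 1 ≤ k)
    (hU : U.Finite) (hEU : ∀ e ∈ 𝓔, e ⊆ U) (hcard : ∀ e ∈ 𝓔, e.ncard = k)
    (hpart : ¬ ∃ χ : W → Fin k, ∀ e ∈ 𝓔, Set.InjOn χ e) :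
    (∃ ℓ h, IsHole (shadow 𝓔) ℓ h) ∨
      ∃ s : Finset W, 3 ≤ s.card ∧ (∀ e ∈ 𝓔, ¬ (s : Set W) ⊆ e) ∧
        ∀ x ∈ s, ∃ e ∈ 𝓔, (s : Set W) \ {x} ⊆ e := by
  classical
  by_contra hno
  rw [not_or] at hno
  obtain ⟨hhole, hsimp⟩ := hno
  have hconf : ∀ s : Finset W, 2 ≤ s.card → (shadow 𝓔).IsClique s → ∃ e ∈ 𝓔, (s : Set W) ⊆ e := by
    intro s
    induction s using Finset.strongInduction with
    | H s ih =>
    intro hs hcl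
    by_contra hne
    push Not at hne
    rcases hs.eq_or_lt with h2 | h3
    · obtain ⟨x, y, hxy, rfl⟩ := Finset.card_eq_two.1 h2.symm
      obtain ⟨-, e, he, hx, hy⟩ := hcl (by simp : x ∈ _) (by simp : y ∈ _) hxy
      exact hne e he (by simp [Set.insert_subset_iff, hx, hy])
    · refine hsimp ⟨s, h3, hne, fun x hx => ?_⟩
      have := ih (s.erase x) (Finset.erase_ssubset hx)
        (by rw [Finset.card_erase_of_mem hx]; omega)
        (hcl.subset (by exact_mod_cast Finset.erase_subset x s))
      simpa using this
  have hfree : (shadow 𝓔).CliqueFree (k + 1) := by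
    intro s hs
    obtain ⟨e, he, hse⟩ := hconf s (by rw [hs.card_eq]; omega) hs.isClique
    have := Set.ncard_le_ncard hse (hU.subset (hEU e he))
    rw [Set.ncard_coe_finset, hs.card_eq, hcard e he] at this
    omega
  obtain ⟨χ, hχ⟩ := exists_coloring_of_no_hole _ hk hhole hfree hU.toFinset
  refine hpart ⟨χ, fun e he u hu w hw h => ?_⟩
  by_contra hne
  exact hχ u (by simpa using hEU e he hu) w (by simpa using hEU e he hw) ⟨hne, e, he, hu, hw⟩ h

/-! ### Sets without nontrivial solutions of an averaging equation -/

/-- No element of `A` is the average of at most `L` elements of `A`, unless these are all equal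
to it. Since `m` need not be invertible, the average is expressed by `∑ a i = m • b`. -/
def AverageFree {H : Type*} [AddCommMonoid H] (L : ℕ) (A : Set H) : Prop :=
  ∀ m ≤ L, ∀ a : ℕ → H, (∀ i < m, a i ∈ A) → ∀ b ∈ A,
    ∑ i ∈ Finset.range m, a i = m • b → ∀ i < m, a i = b

/-- Behrend's construction in `(ℤ/p)^D`: the points with coordinates in `[0, d)` on a sphere. As
`L * d ≤ p`, sums of at most `L` such points do not wrap around, and a sphere is strictly convex. -/
theorem exists_averageFree (p D d L : ℕ) (hL : 1 ≤ L) (hd : L * d ≤ p) :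
    ∃ A : Finset (Fin D → ZMod p), ((d : ℝ) ^ D / (D * d ^ 2) ≤ A.card) ∧
      AverageFree L (A : Set (Fin D → ZMod p)) := by
  classical
  obtain ⟨R, hR⟩ := Behrend.exists_large_sphere D d
  let φ : (Fin D → ℕ) → (Fin D → ZMod p) := fun x i => (x i : ZMod p)
  have hdp : d ≤ p := (Nat.le_mul_of_pos_left d hL).trans hd
  have hbox : ∀ x ∈ Behrend.sphere D d R, ∀ i, x i < d := fun x hx =>
    Behrend.mem_box.1 (Behrend.sphere_subset_box hx)
  have hcast : ∀ a b : ℕ, a < p → b < p → (a : ZMod p) = b → a = b := fun a b ha hb h => by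
    rw [ZMod.natCast_eq_natCast_iff'] at h
    rwa [Nat.mod_eq_of_lt ha, Nat.mod_eq_of_lt hb] at h
  have hinj : Set.InjOn φ (Behrend.sphere D d R) := fun x hx y hy h => funext fun i =>
    hcast _ _ ((hbox x hx i).trans_le hdp) ((hbox y hy i).trans_le hdp) (congrFun h i)
  refine ⟨(Behrend.sphere D d R).image φ, ?_, ?_⟩
  · rw [Finset.card_image_of_injOn hinj]
    exact_mod_cast hR
  · intro m hm a ha b hb hsum
    obtain ⟨y, hy, rfl⟩ := Finset.mem_image.1 (Finset.mem_coe.1 hb)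
    have hx : ∀ i, ∃ x : Fin D → ℕ, i < m → x ∈ Behrend.sphere D d R ∧ φ x = a i := by
      intro i
      by_cases hi : i < m
      · obtain ⟨x, hx, hxa⟩ := Finset.mem_image.1 (Finset.mem_coe.1 (ha i hi))
        exact ⟨x, fun _ => ⟨hx, hxa⟩⟩
      · exact ⟨0, fun h => absurd h hi⟩
    choose x hx using hx
    have hsumN : ∀ t, ∑ i ∈ Finset.range m, x i t = m * y t := by
      intro t
      rcases Nat.eq_zero_or_pos m with rfl | hm0
      · simp
      have hmd : m * d ≤ p := (Nat.mul_le_mul_right d hm).trans hd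
      refine hcast _ _ ?_ ?_ ?_
      · refine lt_of_lt_of_le (Finset.sum_lt_sum_of_nonempty (g := fun _ => d)
          ⟨0, Finset.mem_range.2 hm0⟩ fun i hi => hbox _ (hx i (Finset.mem_range.1 hi)).1 t) ?_
        simpa using hmd
      · exact (Nat.mul_lt_mul_of_pos_left (hbox y hy t) hm0).trans_le hmd
      · have := congrFun hsum t
        rw [Finset.sum_apply, Pi.smul_apply, nsmul_eq_mul] at this
        push_cast
        rw [← this]
        exact Finset.sum_congr rfl fun i hi => congrFun (hx i (Finset.mem_range.1 hi)).2 t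
    have hnorm : ∀ z ∈ Behrend.sphere D d R, ∑ t, (z t : ℤ) ^ 2 = R := fun z hz => by
      exact_mod_cast (Finset.mem_filter.1 hz).2
    -- The points `x i` have the same norm as their average `y`, so their variance vanishes.
    have hvar : ∑ i ∈ Finset.range m, ∑ t, ((x i t : ℤ) - y t) ^ 2 = 0 := by
      have h1 : ∀ i ∈ Finset.range m, ∑ t, ((x i t : ℤ) - y t) ^ 2
          = 2 * R - 2 * ∑ t, (x i t : ℤ) * y t := by
        intro i hi
        rw [two_mul (R : ℤ)]
        nth_rw 1 [← hnorm _ (hx i (Finset.mem_range.1 hi)).1]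
        rw [← hnorm y hy, Finset.mul_sum, ← Finset.sum_add_distrib, ← Finset.sum_sub_distrib]
        exact Finset.sum_congr rfl fun t _ => by ring
      have h2 : ∑ i ∈ Finset.range m, ∑ t, (x i t : ℤ) * y t = m * R := by
        rw [Finset.sum_comm, ← hnorm y hy, Finset.mul_sum]
        refine Finset.sum_congr rfl fun t _ => ?_
        rw [← Finset.sum_mul, ← Nat.cast_sum, hsumN t]
        push_cast
        ring
      rw [Finset.sum_congr rfl h1, Finset.sum_sub_distrib]
      simp only [← Finset.mul_sum]
      rw [h2]
      simp
    intro i hi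
    rw [← (hx i hi).2]
    have hi0 := (Finset.sum_eq_zero_iff_of_nonneg
      (fun i _ => Finset.sum_nonneg fun t _ => sq_nonneg _)).1 hvar i (Finset.mem_range.2 hi)
    congr 1
    funext t
    have ht := (Finset.sum_eq_zero_iff_of_nonneg (fun t _ => sq_nonneg _)).1 hi0 t
      (Finset.mem_univ t)
    have := sub_eq_zero.1 (pow_eq_zero_iff two_ne_zero |>.1 ht)
    exact_mod_cast this

/-! ### Counting in finite vector spaces -/

/-- All fibres of a surjective homomorphism of finite groups have the same size. -/
theorem card_filter_mem_mul_card {X Y : Type*} [AddGroup X] [AddGroup Y] [Fintype X] [Fintype Y]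
    [DecidableEq Y] (f : X →+ Y) (hf : Function.Surjective f) (A : Finset Y) :
    (Finset.univ.filter fun x => f x ∈ A).card * Fintype.card Y = A.card * Fintype.card X := by
  have hfib : ∀ y, (Finset.univ.filter fun x => f x = y).card
      = (Finset.univ.filter fun x => f x = 0).card := fun y =>
    AddMonoidHom.card_fiber_eq_of_mem_range f (hf y) (hf 0)
  have hcount : ∀ B : Finset Y, (Finset.univ.filter fun x => f x ∈ B).card
      = B.card * (Finset.univ.filter fun x => f x = 0).card := by
    intro B
    rw [Finset.card_eq_sum_card_fiberwise (f := f) (t := B) (fun x hx => by simpa using hx),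
      ← smul_eq_mul, ← Finset.sum_const]
    refine Finset.sum_congr rfl fun y hy => ?_
    rw [← hfib y, Finset.filter_filter]
    congr 1
    ext x
    simp only [Finset.mem_filter, Finset.mem_univ, true_and, and_iff_right_iff_imp]
    rintro rfl
    exact hy
  have huniv := hcount Finset.univ
  simp only [Finset.mem_univ, Finset.filter_true, Finset.card_univ] at huniv
  rw [hcount A, huniv]
  ring

/-- A vector space over `𝔽_q` is not the union of fewer than `q` proper subspaces. -/
theorem exists_forall_notMem_submodule {K M ι : Type*} [Field K] [Fintype K] [AddCommGroup M]
    [Module K M] [Finite M] (s : Finset ι) (P : ι → Submodule K M) (hP : ∀ i ∈ s, P i ≠ ⊤)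
    (hs : s.card < Fintype.card K) : ∃ z, ∀ i ∈ s, z ∉ P i := by
  classical
  have := Fintype.ofFinite M
  by_contra! hcov
  have hsmall : ∀ i ∈ s, (Finset.univ.filter fun z => z ∈ P i).card * Fintype.card K
      ≤ Fintype.card M := by
    intro i hi
    have h1 : (Finset.univ.filter fun z => z ∈ P i).card = Fintype.card (P i) :=
      (Fintype.card_subtype _).symm
    rw [h1, Module.card_eq_pow_finrank (K := K) (V := P i),
      Module.card_eq_pow_finrank (K := K) (V := M), ← pow_succ]
    exact Nat.pow_le_pow_right Fintype.card_pos (Submodule.finrank_lt (hP i hi))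
  have hle : Fintype.card M ≤ ∑ i ∈ s, (Finset.univ.filter fun z => z ∈ P i).card := by
    refine le_trans ?_ Finset.card_biUnion_le
    rw [← Finset.card_univ]
    refine Finset.card_le_card fun z _ => ?_
    obtain ⟨i, hi, hz⟩ := hcov z
    exact Finset.mem_biUnion.2 ⟨i, hi, by simpa using hz⟩
  have h2 : Fintype.card M * Fintype.card K ≤ s.card * Fintype.card M := by
    refine (Nat.mul_le_mul_right _ hle).trans ?_
    rw [Finset.sum_mul, ← smul_eq_mul]
    exact Finset.sum_le_card_nsmul _ _ _ hsmall
  rw [mul_comm] at h2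
  have hM : 0 < Fintype.card M := Fintype.card_pos_iff.2 ⟨0⟩
  exact absurd (Nat.le_of_mul_le_mul_right h2 hM) (by omega)

/-- Over a field with more elements than there are edges, vectors on `S` that are independent on
each edge extend to vectors on all vertices that are independent on each edge. -/
theorem exists_linearIndepOn_extension {K W : Type*} [Field K] [Fintype K] {k : ℕ}
    {𝓔 : Set (Set W)} {U : Set W} (hU : U.Finite) (hEU : ∀ e ∈ 𝓔, e ⊆ U)
    (hcard : ∀ e ∈ 𝓔, e.ncard = k) (hK : 𝓔.ncard < Fintype.card K) (S : Set W)
    (c : W → Fin k → K) (hc : ∀ e ∈ 𝓔, LinearIndepOn K c (e ∩ S)) :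
    ∃ c' : W → Fin k → K, Set.EqOn c' c S ∧ ∀ e ∈ 𝓔, LinearIndepOn K c' e := by
  classical
  have hfin : 𝓔.Finite := hU.finite_subsets.subset hEU
  suffices h : ∀ X : Finset W, ∃ c' : W → Fin k → K, Set.EqOn c' c S ∧
      ∀ e ∈ 𝓔, LinearIndepOn K c' (e ∩ (S ∪ X)) by
    obtain ⟨c', h1, h2⟩ := h hU.toFinset
    refine ⟨c', h1, fun e he => (h2 e he).mono ?_⟩
    exact Set.subset_inter subset_rfl fun x hx => Or.inr (by simpa using hEU e he hx)
  intro X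
  induction X using Finset.induction_on with
  | empty => exact ⟨c, fun _ _ => rfl, by simpa using hc⟩
  | insert u X huX ih =>
    obtain ⟨c', h1, h2⟩ := ih
    by_cases huS : u ∈ S
    · refine ⟨c', h1, fun e he => (h2 e he).mono ?_⟩
      rintro x ⟨hx, hx' | hx'⟩
      · exact ⟨hx, Or.inl hx'⟩
      · rcases Finset.mem_insert.1 (Finset.mem_coe.1 hx') with rfl | h
        · exact ⟨hx, Or.inl huS⟩
        · exact ⟨hx, Or.inr h⟩
    have hu : u ∉ S ∪ (X : Set W) := by simp [huS, huX]
    obtain ⟨z, hz⟩ := exists_forall_notMem_submodule (hfin.toFinset.filter fun e => u ∈ e)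
      (fun e => Submodule.span K (c' '' (e ∩ (S ∪ X)))) (by
        intro e he
        obtain ⟨he, hue⟩ := Finset.mem_filter.1 he
        rw [Set.Finite.mem_toFinset] at he
        intro htop
        have hef : e.Finite := hU.subset (hEU e he)
        have hlt : (e ∩ (S ∪ X)).ncard < k := by
          rw [← hcard e he]
          exact Set.ncard_lt_ncard ⟨Set.inter_subset_left, fun h => hu (h hue).2⟩ hef
        have hf : (e ∩ (S ∪ X)).Finite := hef.subset Set.inter_subset_left
        have h3 := finrank_span_finset_le_card (R := K) (hf.toFinset.image c')
        rw [Finset.coe_image, hf.coe_toFinset, Set.finrank, htop, finrank_top, Module.finrank_fin_fun] at h3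
        have h4 : (hf.toFinset.image c').card ≤ hf.toFinset.card := Finset.card_image_le
        rw [← Set.ncard_eq_toFinset_card _ hf] at h4
        omega) (by
        refine lt_of_le_of_lt (Finset.card_filter_le _ _) ?_
        rwa [← Set.ncard_eq_toFinset_card _ hfin])
    have heq : ∀ s ⊆ S ∪ (X : Set W), Set.EqOn c' (Function.update c' u z) s := fun s hs x hx =>
      (Function.update_of_ne (fun h : x = u => hu (h ▸ hs hx)) z c').symm
    refine ⟨Function.update c' u z, fun x hx => ?_, fun e he => ?_⟩
    · rw [← heq S Set.subset_union_left hx, h1 hx]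
    have hold : LinearIndepOn K (Function.update c' u z) (e ∩ (S ∪ X)) :=
      (linearIndepOn_congr (heq _ Set.inter_subset_right)).1 (h2 e he)
    by_cases hue : u ∈ e
    · have hins : e ∩ (S ∪ ↑(insert u X)) = insert u (e ∩ (S ∪ X)) := by
        ext x
        by_cases hx : x = u <;> simp [hx, hue]
      rw [hins, linearIndepOn_insert fun h => hu h.2]
      refine ⟨hold, ?_⟩
      rw [Function.update_self, ← (heq _ Set.inter_subset_right).image_eq]
      exact hz e (Finset.mem_filter.2 ⟨hfin.mem_toFinset.2 he, hue⟩)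
    · refine hold.mono ?_
      rintro x ⟨hx, hx' | hx'⟩
      · exact ⟨hx, Or.inl hx'⟩
      · rcases Finset.mem_insert.1 (Finset.mem_coe.1 hx') with rfl | h
        · exact absurd hx hue
        · exact ⟨hx, Or.inr h⟩

/-! ### Vectors realizing an obstruction -/

/-- Parameters `q : Fin k → H` in a `K`-module `H` assign to each vertex `v` the value
`∑ j, c v j • q j`. By `indep` the values on an edge determine `q`. By `relation`, an assignment
`S` that agrees on each edge with the values for some `q` with `∑ j, θ j • q j ∈ A` satisfies a
fixed nontrivial linear relation, for every `A` that is `AverageFree L`. -/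
structure IsObstruction {W K : Type*} [Field K] {k : ℕ} (𝓔 : Set (Set W)) (U : Finset W) (L : ℕ)
    (c : W → Fin k → K) (θ : Fin k → K) (μ : W → K) : Prop where
  indep : ∀ e ∈ 𝓔, LinearIndepOn K c e
  theta_ne : θ ≠ 0
  mu_ne : ∃ u ∈ U, μ u ≠ 0
  relation : ∀ {H : Type} [AddCommGroup H] [Module K H] (A : Set H), AverageFree L A →
    ∀ S : W → H, (∀ e ∈ 𝓔, ∃ q : Fin k → H, Fintype.linearCombination K q θ ∈ A ∧
      ∀ v ∈ e, S v = Fintype.linearCombination K q (c v)) → ∑ u ∈ U, μ u • S u = 0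

theorem IsHole.symm_adj_iff {W : Type*} {G : SimpleGraph W} {ℓ : ℕ} {h : ℕ → W}
    (hh : IsHole G ℓ h) {i j : ℕ} (hi : i < ℓ) (hj : j < ℓ) (hij : i ≠ j)
    (hadj : G.Adj (h i) (h j)) :
    j = i + 1 ∨ i = j + 1 ∨ i = 0 ∧ j + 1 = ℓ ∨ j = 0 ∧ i + 1 = ℓ := by
  rcases lt_or_gt_of_ne hij with h | h
  · have := (hh.adj_iff i j h hj).1 hadj
    omega
  · have := (hh.adj_iff j i h hi).1 hadj.symm
    omega

theorem IsHole.injOn {W : Type*} {G : SimpleGraph W} {ℓ : ℕ} {h : ℕ → W}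
    (hh : IsHole G ℓ h) : Set.InjOn h {i | i < ℓ} := fun i hi j hj heq => by
  by_contra hij
  rcases lt_or_gt_of_ne hij with h' | h'
  · exact hh.ne i j h' hj heq
  · exact hh.ne j i h' hi heq.symm

/-- An edge contains at most two vertices of a hole of the 2-shadow. -/
theorem IsHole.exists_pair {W : Type*} {𝓔 : Set (Set W)} {ℓ : ℕ} {h : ℕ → W}
    (hh : IsHole (shadow 𝓔) ℓ h) {e : Set W} (he : e ∈ 𝓔) :
    ∃ i j, i < ℓ ∧ j < ℓ ∧ i ≠ j ∧ e ∩ h '' {i | i < ℓ} ⊆ {h i, h j} := by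
  classical
  let I : Finset ℕ := (Finset.range ℓ).filter fun i => h i ∈ e
  have hI : I.card ≤ 2 := by
    by_contra hlt
    obtain ⟨a, ha, b, hb, c, hc, hab, hac, hbc⟩ := Finset.two_lt_card.1 (not_le.1 hlt)
    simp only [I, Finset.mem_filter, Finset.mem_range] at ha hb hc
    have hadj : ∀ i j, i < ℓ → j < ℓ → i ≠ j → h i ∈ e → h j ∈ e → (shadow 𝓔).Adj (h i) (h j) :=
      fun i j hi hj hij hie hje => ⟨fun heq => hij (hh.injOn hi hj heq), e, he, hie, hje⟩
    have h1 := hh.symm_adj_iff ha.1 hb.1 hab (hadj a b ha.1 hb.1 hab ha.2 hb.2)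
    have h2 := hh.symm_adj_iff ha.1 hc.1 hac (hadj a c ha.1 hc.1 hac ha.2 hc.2)
    have h3 := hh.symm_adj_iff hb.1 hc.1 hbc (hadj b c hb.1 hc.1 hbc hb.2 hc.2)
    have := hh.four_le
    omega
  obtain ⟨J, hIJ, hJ, hJ2⟩ := Finset.exists_subsuperset_card_eq (Finset.filter_subset _ _) hI
    (by rw [Finset.card_range]; have := hh.four_le; omega)
  obtain ⟨i, j, hij, rfl⟩ := Finset.card_eq_two.1 hJ2
  refine ⟨i, j, Finset.mem_range.1 (hJ (by simp)), Finset.mem_range.1 (hJ (by simp)), hij, ?_⟩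
  rintro _ ⟨hxe, t, ht, rfl⟩
  have := hIJ (Finset.mem_filter.2 ⟨Finset.mem_range.2 ht, hxe⟩)
  simp only [Finset.mem_insert, Finset.mem_singleton] at this
  rcases this with rfl | rfl <;> simp

/-- A hole gives an obstruction: its vertices get the values `x + i • a`, `i < ℓ`. Consistency on
edges forces differences `a₀, …, a_{ℓ-2}` along the cycle to have as average the difference
belonging to the closing edge. -/
theorem exists_isObstruction_of_isHole {W : Type*} {p k L : ℕ} [Fact p.Prime] {𝓔 : Set (Set W)}
    {U : Finset W} (hEU : ∀ e ∈ 𝓔, e ⊆ U) (hcard : ∀ e ∈ 𝓔, e.ncard = k)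
    (hp : 𝓔.ncard < p) (hL : U.card ≤ L) (hLp : L ≤ p)
    (hhole : ∃ ℓ h, IsHole (shadow 𝓔) ℓ h) :
    ∃ (c : W → Fin k → ZMod p) (θ : Fin k → ZMod p) (μ : W → ZMod p),
      IsObstruction 𝓔 U L c θ μ := by
  classical
  obtain ⟨ℓ, h, hh⟩ := hhole
  have h4 := hh.four_le
  have hstep : ∀ i, i + 1 < ℓ → ∃ e ∈ 𝓔, h i ∈ e ∧ h (i + 1) ∈ e := fun i hi =>
    ((hh.adj_iff i (i + 1) (by omega) hi).2 (Or.inl rfl)).2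
  obtain ⟨e₁, he₁, hc₁, hc₂⟩ := ((hh.adj_iff 0 (ℓ - 1) (by omega) (by omega)).2
    (Or.inr ⟨rfl, by omega⟩)).2
  have hhU : ∀ i < ℓ, h i ∈ U := by
    intro i hi
    rcases Nat.lt_or_ge (i + 1) ℓ with h' | h'
    · obtain ⟨e, he, h1, -⟩ := hstep i h'
      exact hEU e he h1
    · rw [show i = ℓ - 1 by omega]
      exact hEU e₁ he₁ hc₂
  have hℓL : ℓ ≤ L := by
    refine le_trans ?_ hL
    rw [← Finset.card_range ℓ]
    refine Finset.card_le_card_of_injOn h (fun i hi => hhU i (Finset.mem_range.1 hi)) ?_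
    simpa [Set.InjOn] using hh.injOn
  have hk : 2 ≤ k := by
    rw [← hcard e₁ he₁]
    exact (Set.one_lt_ncard (U.finite_toSet.subset (hEU e₁ he₁))).2
      ⟨h 0, hc₁, h (ℓ - 1), hc₂, hh.ne 0 (ℓ - 1) (by omega) (by omega)⟩
  let i₀ : Fin k := ⟨0, by omega⟩
  let i₁ : Fin k := ⟨1, by omega⟩
  have hi01 : i₁ ≠ i₀ := by simp [i₀, i₁]
  let θ : Fin k → ZMod p := Pi.single i₀ 1
  have hidx : ∀ i < ℓ, Function.invFunOn h {i | i < ℓ} (h i) = i := fun i hi =>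
    hh.injOn.leftInvOn_invFunOn hi
  let c₀ : W → Fin k → ZMod p := fun w =>
    Pi.single i₁ 1 + ((Function.invFunOn h {i : ℕ | i < ℓ} w : ℕ) : ZMod p) • θ
  have hc₀ : ∀ i < ℓ, c₀ (h i) = Pi.single i₁ 1 + (i : ZMod p) • θ := fun i hi => by
    simp only [c₀, hidx i hi]
  obtain ⟨c, hcS, hc⟩ := exists_linearIndepOn_extension U.finite_toSet hEU hcard
    (by rwa [ZMod.card]) (h '' {i | i < ℓ}) c₀ (by
      intro e he
      obtain ⟨i, j, hi, hj, hij, hsub⟩ := hh.exists_pair he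
      refine LinearIndepOn.mono ?_ hsub
      have hval : ∀ i < ℓ, c₀ (h i) i₁ = 1 ∧ c₀ (h i) i₀ = i := fun i hi => by
        rw [hc₀ i hi]
        simp [θ, hi01, hi01.symm]
      rw [linearIndepOn_pair_iff _ (fun heq => hij (hh.injOn hi hj heq))
        (fun h0 => by simpa [h0] using (hval i hi).1)]
      intro a ha
      have ha1 := congrFun ha i₁
      have ha0 := congrFun ha i₀
      rw [Pi.smul_apply, (hval i hi).1, (hval j hj).1, smul_eq_mul, mul_one] at ha1
      rw [Pi.smul_apply, (hval i hi).2, (hval j hj).2, ha1, one_smul,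
        ZMod.natCast_eq_natCast_iff', Nat.mod_eq_of_lt (by omega),
        Nat.mod_eq_of_lt (by omega)] at ha0
      exact hij ha0)
  have hcval : ∀ i < ℓ, c (h i) = Pi.single i₁ 1 + (i : ZMod p) • θ := fun i hi => by
    rw [hcS ⟨i, hi, rfl⟩, hc₀ i hi]
  refine ⟨c, θ, Pi.single (h 0) 1 + Pi.single (h 2) 1 - Pi.single (h 1) 2, hc, ?_,
    ⟨h 0, hhU 0 (by omega), ?_⟩, ?_⟩
  · intro h0
    simpa [θ] using congrFun h0 i₀
  · simp [hh.ne 0 1 (by omega) (by omega), hh.ne 0 2 (by omega) (by omega)]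
  · intro H _ _ A hA S hS
    have hdiff : ∀ i, i + 1 < ℓ → S (h (i + 1)) - S (h i) ∈ A := by
      intro i hi
      obtain ⟨e, he, h1, h2⟩ := hstep i hi
      obtain ⟨q, hqA, hq⟩ := hS e he
      have : S (h (i + 1)) - S (h i) = Fintype.linearCombination (ZMod p) q θ := by
        rw [hq _ h1, hq _ h2, ← map_sub, hcval _ hi, hcval i (by omega)]
        congr 1
        push_cast
        module
      rwa [this]
    obtain ⟨q, hqA, hq⟩ := hS e₁ he₁
    have hclose : S (h (ℓ - 1)) - S (h 0)
        = (ℓ - 1) • Fintype.linearCombination (ZMod p) q θ := by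
      rw [hq _ hc₁, hq _ hc₂, ← map_sub, hcval _ (by omega), hcval 0 (by omega), ← map_nsmul,
        ← Nat.cast_smul_eq_nsmul (ZMod p)]
      congr 1
      push_cast
      module
    have hall := hA (ℓ - 1) (by omega) (fun i => S (h (i + 1)) - S (h i))
      (fun i hi => hdiff i (by omega)) _ hqA
      ((Finset.sum_range_sub (fun i => S (h i)) (ℓ - 1)).trans hclose)
    have h01 : S (h 1) - S (h 0) = S (h 2) - S (h 1) :=
      (hall 0 (by omega)).trans (hall 1 (by omega)).symm
    have hsum : ∀ (u : W) (x : ZMod p), u ∈ U →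
        ∑ w ∈ U, (Pi.single u x : W → ZMod p) w • S w = x • S u := by
      intro u x hu
      rw [Finset.sum_eq_single_of_mem u hu fun w _ hw => by
        rw [Pi.single_eq_of_ne hw, zero_smul], Pi.single_eq_same]
    simp only [Pi.add_apply, Pi.sub_apply, add_smul, sub_smul, Finset.sum_add_distrib,
      Finset.sum_sub_distrib]
    rw [hsum _ _ (hhU 0 (by omega)), hsum _ _ (hhU 1 (by omega)), hsum _ _ (hhU 2 (by omega)),
      one_smul, one_smul, two_smul, sub_eq_zero]
    have h3 := sub_eq_sub_iff_add_eq_add.1 h01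
    rw [h3, add_comm]

/-- A simplex gives an obstruction: its vertices get values that are generic subject to their sum
`β` being zero. Omitting `x₀`, `x₁` or `x₂`, consistency on edges produces three elements of `A`
that form an arithmetic progression with difference `-β`. -/
theorem exists_isObstruction_of_simplex {W : Type*} {p k L : ℕ} [Fact p.Prime] {𝓔 : Set (Set W)}
    {U : Finset W} (hEU : ∀ e ∈ 𝓔, e ⊆ U) (hcard : ∀ e ∈ 𝓔, e.ncard = k)
    (hp : 𝓔.ncard < p) (hL : 2 ≤ L) {s : Finset W} (hs3 : 3 ≤ s.card)
    (hs : ∀ e ∈ 𝓔, ¬ (s : Set W) ⊆ e) (hsub : ∀ x ∈ s, ∃ e ∈ 𝓔, (s : Set W) \ {x} ⊆ e) :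
    ∃ (c : W → Fin k → ZMod p) (θ : Fin k → ZMod p) (μ : W → ZMod p),
      IsObstruction 𝓔 U L c θ μ := by
  classical
  obtain ⟨x₀, hx₀, x₁, hx₁, x₂, hx₂, h01, h02, h12⟩ := Finset.two_lt_card.1 (by omega : 2 < s.card)
  have hsU : ∀ x ∈ s, x ∈ U := by
    intro x hx
    obtain ⟨y, hy, hyx⟩ : ∃ y ∈ s, x ≠ y := by
      by_cases h : x = x₀
      · exact ⟨x₁, hx₁, h ▸ h01⟩
      · exact ⟨x₀, hx₀, h⟩
    obtain ⟨e, he, hse⟩ := hsub y hy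
    exact hEU e he (hse ⟨hx, hyx⟩)
  obtain ⟨idx⟩ : Nonempty ((s.erase x₀ : Finset W) ↪ Fin k) := by
    obtain ⟨e, he, hse⟩ := hsub x₀ hx₀
    refine Function.Embedding.nonempty_of_card_le ?_
    rw [Fintype.card_coe, Fintype.card_fin, ← hcard e he, ← Set.ncard_coe_finset]
    refine Set.ncard_le_ncard (by simpa using hse) (U.finite_toSet.subset (hEU e he))
  let d : W → Fin k → ZMod p := fun w =>
    if h : w ∈ s.erase x₀ then Pi.single (idx ⟨w, h⟩) 1 else 0
  have hd : ∀ w (h : w ∈ s.erase x₀), d w = Pi.single (idx ⟨w, h⟩) 1 := fun w h => dif_pos h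
  have hdeval : ∀ (g : W → ZMod p) (w : W) (h : w ∈ s.erase x₀),
      (∑ i ∈ s.erase x₀, g i • d i) (idx ⟨w, h⟩) = g w := by
    intro g w h
    rw [Finset.sum_apply, Finset.sum_eq_single_of_mem w h]
    · rw [Pi.smul_apply, hd w h, Pi.single_eq_same, smul_eq_mul, mul_one]
    · intro i hi hiw
      rw [Pi.smul_apply, hd i hi, Pi.single_eq_of_ne, smul_zero]
      exact fun heq => hiw (congrArg Subtype.val (idx.injective heq)).symm
  let c₀ : W → Fin k → ZMod p := fun w => if w = x₀ then - ∑ i ∈ s.erase x₀, d i else d w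
  have hc₀x : c₀ x₀ = - ∑ i ∈ s.erase x₀, d i := if_pos rfl
  have hc₀d : ∀ w, w ≠ x₀ → c₀ w = d w := fun w hw => if_neg hw
  have hcomb : ∀ g : W → ZMod p, ∑ i ∈ s, g i • c₀ i = ∑ i ∈ s.erase x₀, (g i - g x₀) • d i := by
    intro g
    rw [← Finset.add_sum_erase s _ hx₀, hc₀x, smul_neg, Finset.smul_sum, neg_add_eq_sub,
      ← Finset.sum_sub_distrib]
    refine Finset.sum_congr rfl fun i hi => ?_
    rw [hc₀d i (Finset.ne_of_mem_erase hi), sub_smul]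
  obtain ⟨c, hcS, hc⟩ := exists_linearIndepOn_extension U.finite_toSet hEU hcard
    (by rwa [ZMod.card]) s c₀ (by
      intro e he
      obtain ⟨j, hj, hje⟩ := Set.not_subset.1 (hs e he)
      have hsub' : e ∩ s ⊆ (s.erase j : Finset W) := fun x hx =>
        Finset.mem_coe.2 (Finset.mem_erase.2 ⟨fun h => hje (h ▸ hx.1), hx.2⟩)
      refine LinearIndepOn.mono ?_ hsub'
      rw [linearIndepOn_finset_iff]
      intro g hg i hi
      have hg' : ∑ i ∈ s, Function.update g j 0 i • c₀ i = 0 := by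
        rw [← Finset.add_sum_erase s _ hj, Function.update_self, zero_smul, zero_add, ← hg]
        exact Finset.sum_congr rfl fun w hw => by
          rw [Function.update_of_ne (Finset.ne_of_mem_erase hw)]
      rw [hcomb] at hg'
      -- All coefficients of a relation between the vectors of the simplex are equal.
      have hconst : ∀ w ∈ s, Function.update g j 0 w = Function.update g j 0 x₀ := by
        intro w hw
        by_cases hwx : w = x₀
        · rw [hwx]
        · have hw' := Finset.mem_erase.2 ⟨hwx, hw⟩
          have := hdeval (fun i => Function.update g j 0 i - Function.update g j 0 x₀) w hw'
          rw [hg'] at this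
          exact sub_eq_zero.1 this.symm
      have h1 := (hconst i (Finset.mem_of_mem_erase hi)).trans (hconst j hj).symm
      rwa [Function.update_self, Function.update_of_ne (Finset.ne_of_mem_erase hi)] at h1)
  have hcsum : ∑ i ∈ s, c i = 0 := by
    rw [Finset.sum_congr rfl fun i hi => hcS hi]
    simpa using hcomb fun _ => 1
  have hx₁' : x₁ ∈ s.erase x₀ := Finset.mem_erase.2 ⟨h01.symm, hx₁⟩
  have hx₂' : x₂ ∈ s.erase x₀ := Finset.mem_erase.2 ⟨h02.symm, hx₂⟩
  refine ⟨c, c x₁ + (2 : ZMod p) • c x₂, fun w => if w ∈ s then 1 else 0, hc, ?_,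
    ⟨x₀, hsU x₀ hx₀, by simp [hx₀]⟩, ?_⟩
  · intro h0
    have := congrFun h0 (idx ⟨x₁, hx₁'⟩)
    rw [hcS hx₁, hcS hx₂, hc₀d _ h01.symm, hc₀d _ h02.symm, hd _ hx₁', hd _ hx₂', Pi.add_apply,
      Pi.smul_apply, Pi.single_eq_same, Pi.single_eq_of_ne] at this
    · simp at this
    · exact fun heq => h12 (congrArg Subtype.val (idx.injective heq))
  · intro H _ _ A hA S hS
    have hβ : ∑ u ∈ U, (if u ∈ s then (1 : ZMod p) else 0) • S u = ∑ u ∈ s, S u := by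
      simp only [ite_smul, one_smul, zero_smul]
      rw [← Finset.sum_filter]
      refine Finset.sum_congr ?_ fun _ _ => rfl
      ext u
      simpa using hsU u
    rw [hβ]
    set β := ∑ u ∈ s, S u with hβdef
    have hq : ∀ j ∈ s, ∃ q : Fin k → H,
        Fintype.linearCombination (ZMod p) q (c x₁ + (2 : ZMod p) • c x₂) ∈ A ∧
        (∀ i ∈ s, i ≠ j → Fintype.linearCombination (ZMod p) q (c i) = S i) ∧
        Fintype.linearCombination (ZMod p) q (c j) = S j - β := by
      intro j hj
      obtain ⟨e, he, hse⟩ := hsub j hj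
      obtain ⟨q, hqA, hq⟩ := hS e he
      have hi : ∀ i ∈ s, i ≠ j → Fintype.linearCombination (ZMod p) q (c i) = S i :=
        fun i hi hij => (hq i (hse ⟨hi, hij⟩)).symm
      refine ⟨q, hqA, hi, ?_⟩
      have h0 := congrArg (Fintype.linearCombination (ZMod p) q) hcsum
      rw [map_zero, map_sum, ← Finset.add_sum_erase s _ hj,
        Finset.sum_congr rfl fun i hi' =>
          hi i (Finset.mem_of_mem_erase hi') (Finset.ne_of_mem_erase hi')] at h0
      rw [hβdef, ← Finset.add_sum_erase s _ hj, eq_neg_of_add_eq_zero_left h0]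
      abel
    obtain ⟨q₀, hA₀, hq₀, -⟩ := hq x₀ hx₀
    obtain ⟨q₁, hA₁, hq₁, hq₁'⟩ := hq x₁ hx₁
    obtain ⟨q₂, hA₂, hq₂, hq₂'⟩ := hq x₂ hx₂
    rw [map_add, map_smul, hq₀ x₁ hx₁ h01.symm, hq₀ x₂ hx₂ h02.symm] at hA₀
    rw [map_add, map_smul, hq₁', hq₁ x₂ hx₂ h12.symm] at hA₁
    rw [map_add, map_smul, hq₂', hq₂ x₁ hx₁ h12] at hA₂
    have key := hA 2 hL (fun i => if i = 0 then S x₁ + (2 : ZMod p) • S x₂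
      else S x₁ + (2 : ZMod p) • (S x₂ - β)) (by
        intro i _
        split_ifs
        · exact hA₀
        · exact hA₂) _ hA₁ (by
        simp only [Finset.sum_range_succ, Finset.sum_range_zero, if_pos, one_ne_zero, if_false]
        rw [← Nat.cast_smul_eq_nsmul (ZMod p)]
        push_cast
        module) 0 (by omega)
    simp only [if_pos] at key
    have : β = (S x₁ + (2 : ZMod p) • S x₂) - (S x₁ - β + (2 : ZMod p) • S x₂) := by abel
    rw [this, key, sub_self]

/-- Set systems that are not `k`-partite have obstructions over `ℤ/p` for all large primes `p`. -/
theorem exists_isObstruction {W : Type*} {p k L : ℕ} [Fact p.Prime] (hk : 1 ≤ k)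
    {𝓔 : Set (Set W)} {U : Finset W} (hEU : ∀ e ∈ 𝓔, e ⊆ U) (hcard : ∀ e ∈ 𝓔, e.ncard = k)
    (hpart : ¬ ∃ χ : W → Fin k, ∀ e ∈ 𝓔, Set.InjOn χ e)
    (hp : 𝓔.ncard < p) (hL : U.card ≤ L) (hL2 : 2 ≤ L) (hLp : L ≤ p) :
    ∃ (c : W → Fin k → ZMod p) (θ : Fin k → ZMod p) (μ : W → ZMod p),
      IsObstruction 𝓔 U L c θ μ := by
  rcases exists_isHole_or_simplex hk U.finite_toSet hEU hcard hpart with h | ⟨s, h1, h2, h3⟩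
  · exact exists_isObstruction_of_isHole hEU hcard hp hL hLp h
  · exact exists_isObstruction_of_simplex hEU hcard hp hL2 h1 h2 h3

/-! ### Cores -/

/-- `r` is a homomorphism from `F` to itself. -/
structure IsEndo {W : Type*} (F : Hypergraph W) (r : W → W) : Prop where
  mapsTo : Set.MapsTo r V(F) V(F)
  image_mem : ∀ e ∈ E(F), r '' e ∈ E(F)

/-- `r` is an endomorphism of `F` whose image on the vertices is minimal. The hypergraph that `F`
induces on this image is the core of `F`. -/
structure IsCoreMap {W : Type*} (F : Hypergraph W) (r : W → W) : Prop extends IsEndo F r where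
  minimal : ∀ τ, IsEndo F τ → τ '' V(F) ⊆ r '' V(F) → τ '' V(F) = r '' V(F)

/-- The edges of `F` inside the image of `r`. -/
def coreEdges {W : Type*} (F : Hypergraph W) (r : W → W) : Set (Set W) :=
  {e ∈ E(F) | e ⊆ r '' V(F)}

theorem exists_isCoreMap {W : Type*} {F : Hypergraph W} (hfin : V(F).Finite) :
    ∃ r, IsCoreMap F r := by
  classical
  have hex : ∃ n r, IsEndo F r ∧ (r '' V(F)).ncard = n :=
    ⟨_, id, ⟨fun _ h => h, fun e he => by simpa using he⟩, rfl⟩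
  obtain ⟨r, hr, hn⟩ := Nat.find_spec hex
  refine ⟨r, hr, fun τ hτ hsub => Set.eq_of_subset_of_ncard_le hsub ?_ (hfin.image r)⟩
  rw [hn]
  exact Nat.find_min' hex ⟨τ, hτ, rfl⟩

theorem IsEndo.comp {W : Type*} {F : Hypergraph W} {τ r : W → W} (hτ : IsEndo F τ)
    (hr : IsEndo F r) : IsEndo F (τ ∘ r) :=
  ⟨hτ.mapsTo.comp hr.mapsTo, fun e he => by
    rw [Set.image_comp]; exact hτ.image_mem _ (hr.image_mem e he)⟩

theorem IsCoreMap.image_mem_coreEdges {W : Type*} {F : Hypergraph W} {r : W → W}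
    (hr : IsCoreMap F r) {e : Set W} (he : e ∈ E(F)) : r '' e ∈ coreEdges F r :=
  ⟨hr.image_mem e he, Set.image_mono (F.subset_vertexSet_of_mem_edgeSet' he)⟩

theorem finite_of_mem_edgeSet {W : Type*} {F : Hypergraph W} (hfin : V(F).Finite) {e : Set W}
    (he : e ∈ E(F)) : e.Finite :=
  hfin.subset (F.subset_vertexSet_of_mem_edgeSet' he)

theorem IsCoreMap.injOn_edge {W : Type*} {F : Hypergraph W} {r : W → W} {k : ℕ}
    (hr : IsCoreMap F r) (hfin : V(F).Finite) (hF : F.IsUniform k) {e : Set W} (he : e ∈ E(F)) :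
    Set.InjOn r e :=
  Set.injOn_of_ncard_image_eq ((hF _ (hr.image_mem e he)).trans (hF e he).symm)
    (finite_of_mem_edgeSet hfin he)

/-- A colouring of the core pulls back to a colouring of `F`. -/
theorem IsCoreMap.isPartite {W : Type*} {F : Hypergraph W} {r : W → W} {k : ℕ}
    (hr : IsCoreMap F r) (hfin : V(F).Finite) (hF : F.IsUniform k)
    (hχ : ∃ χ : W → Fin k, ∀ e ∈ coreEdges F r, Set.InjOn χ e) : F.IsPartite k := by
  obtain ⟨χ, hχ⟩ := hχ
  refine ⟨χ ∘ r, fun e he => ?_⟩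
  have hinj : Set.InjOn (χ ∘ r) e := (hχ _ (hr.image_mem_coreEdges he)).comp
    (hr.injOn_edge hfin hF he) (Set.mapsTo_image r e)
  refine ⟨Set.mapsTo_univ _ _, hinj, ?_⟩
  have : χ ∘ r '' e = Set.univ := by
    refine Set.eq_of_subset_of_ncard_le (Set.subset_univ _) ?_
    rw [hinj.ncard_image, hF e he, Set.ncard_univ, Nat.card_fin]
  exact this.ge

/-- An endomorphism of `F` into the core restricts to an automorphism of the core; `t` is the
inverse of this restriction. -/
theorem IsCoreMap.exists_inverse {W : Type*} {F : Hypergraph W} {r τ : W → W}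
    (hr : IsCoreMap F r) (hfin : V(F).Finite) (hτ : IsEndo F τ) (hsub : τ '' V(F) ⊆ r '' V(F)) :
    ∃ t : W → W, (∀ u ∈ r '' V(F), t u ∈ r '' V(F) ∧ τ (t u) = u) ∧
      ∀ e ∈ coreEdges F r, t '' e ∈ E(F) := by
  have hUV : r '' V(F) ⊆ V(F) := hr.mapsTo.image_subset
  have hUfin : (r '' V(F)).Finite := hfin.image r
  have himage : τ '' (r '' V(F)) = r '' V(F) := by
    rw [← Set.image_comp]
    refine hr.minimal _ (hτ.comp hr.toIsEndo) ?_
    rw [Set.image_comp]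
    exact (Set.image_mono hUV).trans hsub
  have hinj : Set.InjOn τ (r '' V(F)) := Set.injOn_of_ncard_image_eq (by rw [himage]) hUfin
  have hne : ∀ u ∈ r '' V(F), ∃ w ∈ r '' V(F), τ w = u := fun u hu => by rwa [← himage] at hu
  have hEfin : (coreEdges F r).Finite := hUfin.finite_subsets.subset fun e he => he.2
  have hbij : Set.BijOn (Set.image τ) (coreEdges F r) (coreEdges F r) := by
    refine (hEfin.injOn_iff_bijOn_of_mapsTo fun e he => ⟨hτ.image_mem e he.1, ?_⟩).1 ?_
    · exact (Set.image_mono he.2).trans himage.le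
    · intro e he e' he' heq
      exact (hinj.image_eq_image_iff he.2 he'.2).1 heq
  choose! t ht using hne
  refine ⟨t, ht, fun e he => ?_⟩
  obtain ⟨e₀, he₀, rfl⟩ := hbij.surjOn he
  have : t '' (τ '' e₀) = e₀ := by
    rw [← Set.image_comp]
    refine (Set.image_congr fun w hw => ?_).trans (Set.image_id e₀)
    have hw' := ht (τ w) (hsub ⟨w, hUV (he₀.2 hw), rfl⟩)
    exact hinj hw'.1 (he₀.2 hw) hw'.2
  rw [this]
  exact he₀.1

/-! ### Hypergraphs with many edge-disjoint copies but few copies -/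

/-- The placement of the vertices of `F` for the parameters `q`: the vertex `w` goes to the part
with label `ι w`, at the position `∑ j, c (r w) j • q j`. -/
def place {W K H : Type*} [Field K] [AddCommGroup H] [Module K H] {v k : ℕ} (ι : W → Fin v)
    (r : W → W) (c : W → Fin k → K) (q : Fin k → H) (w : W) : Fin v × H :=
  (ι w, Fintype.linearCombination K q (c (r w)))

/-- The union of the copies of `F` placed according to all parameters `q` with
`∑ j, θ j • q j ∈ A`. -/
def placedUnion {W K H : Type*} [Field K] [AddCommGroup H] [Module K H] {v k : ℕ}
    (F : Hypergraph W) (ι : W → Fin v) (r : W → W) (c : W → Fin k → K) (θ : Fin k → K)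
    (A : Set H) : Hypergraph (Fin v × H) where
  vertexSet := Set.univ
  edgeSet := {x | ∃ e ∈ E(F), ∃ q : Fin k → H,
    Fintype.linearCombination K q θ ∈ A ∧ place ι r c q '' e = x}
  subset_vertexSet_of_mem_edgeSet' := fun _ _ => Set.subset_univ _

theorem placedUnion_isUniform {W K H : Type*} [Field K] [AddCommGroup H] [Module K H] {v k : ℕ}
    {F : Hypergraph W} {ι : W → Fin v} {r : W → W} {c : W → Fin k → K} {θ : Fin k → K}
    {A : Set H} (hF : F.IsUniform k) (hι : Set.InjOn ι V(F)) :
    (placedUnion F ι r c θ A).IsUniform k := by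
  rintro _ ⟨e, he, q, -, rfl⟩
  rw [Set.InjOn.ncard_image, hF e he]
  exact fun x hx y hy h => hι (F.subset_vertexSet_of_mem_edgeSet' he hx)
    (F.subset_vertexSet_of_mem_edgeSet' he hy) (congrArg Prod.fst h)

/-- Independence on the edges of the core means that an edge of a placed copy determines the
parameters of the copy. -/
theorem place_image_injective {W K H : Type*} [Field K] [AddCommGroup H] [Module K H] {v k : ℕ}
    {F : Hypergraph W} {ι : W → Fin v} {r : W → W} {c : W → Fin k → K}
    (hr : IsCoreMap F r) (hfin : V(F).Finite) (hF : F.IsUniform k) (hι : Set.InjOn ι V(F))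
    (hc : ∀ e ∈ coreEdges F r, LinearIndepOn K c e)
    {e e' : Set W} (he : e ∈ E(F)) (he' : e' ∈ E(F)) {q q' : Fin k → H}
    (h : place ι r c q '' e = place ι r c q' '' e') : q = q' := by
  classical
  have hre := hr.image_mem_coreEdges he
  have := (finite_of_mem_edgeSet hfin hre.1).fintype
  have hspan : Submodule.span K (c '' (r '' e)) = ⊤ := by
    have := (hc _ hre).linearIndependent.span_eq_top_of_card_eq_finrank' (by
      rw [← Nat.card_eq_fintype_card, Nat.card_coe_set_eq, hF _ hre.1, Module.finrank_fin_fun])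
    rwa [← Set.image_eq_range] at this
  have heq : Fintype.linearCombination K q = Fintype.linearCombination K q' := by
    refine LinearMap.ext_on hspan ?_
    rintro _ ⟨_, ⟨w, hw, rfl⟩, rfl⟩
    obtain ⟨w', hw', hww'⟩ : place ι r c q w ∈ place ι r c q' '' e' := h ▸ ⟨w, hw, rfl⟩
    have h1 := hι (F.subset_vertexSet_of_mem_edgeSet' he' hw')
      (F.subset_vertexSet_of_mem_edgeSet' he hw) (congrArg Prod.fst hww')
    subst h1
    exact (congrArg Prod.snd hww').symm
  funext j
  have hj := LinearMap.congr_fun heq (Pi.single j 1)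
  simpa [Fintype.linearCombination_apply_single] using hj

theorem hasEdgeDisjointCopies_placedUnion {W K H : Type*} [Field K] [AddCommGroup H] [Module K H]
    {v k : ℕ} {F : Hypergraph W} {ι : W → Fin v} {r : W → W} {c : W → Fin k → K} {θ : Fin k → K}
    {A : Set H} (hr : IsCoreMap F r) (hfin : V(F).Finite) (hF : F.IsUniform k)
    (hι : Set.InjOn ι V(F)) (hc : ∀ e ∈ coreEdges F r, LinearIndepOn K c e)
    (hne : E(F).Nonempty) (Q : Finset (Fin k → H))
    (hQ : ∀ q ∈ Q, Fintype.linearCombination K q θ ∈ A) {m : ℝ} (hm : m ≤ Q.card) :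
    HasEdgeDisjointCopies F (placedUnion F ι r c θ A) m := by
  classical
  have hdet : ∀ q q' : Fin k → H, ∀ x, x ∈ E(F.image (place ι r c q)) →
      x ∈ E(F.image (place ι r c q')) → q = q' := by
    rintro q q' _ ⟨e, he, rfl⟩ ⟨e', he', heq⟩
    exact place_image_injective hr hfin hF hι hc he he' heq.symm
  refine ⟨Q.image fun q => F.image (place ι r c q), ?_, ?_, ?_⟩
  · intro G hG
    obtain ⟨q, hq, rfl⟩ := Finset.mem_image.1 hG
    refine ⟨⟨Set.subset_univ _, ?_⟩, _, fun x hx y hy h => hι hx hy (congrArg Prod.fst h), rfl⟩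
    rintro _ ⟨e, he, rfl⟩
    exact ⟨e, he, q, hQ q hq, rfl⟩
  · intro G₁ h₁ G₂ h₂ hne'
    obtain ⟨q₁, -, rfl⟩ := Finset.mem_image.1 h₁
    obtain ⟨q₂, -, rfl⟩ := Finset.mem_image.1 h₂
    refine Set.disjoint_left.2 fun x hx₁ hx₂ => hne' ?_
    rw [hdet q₁ q₂ x hx₁ hx₂]
  · rw [Finset.card_image_of_injective]
    · exact hm
    · intro q q' heq
      obtain ⟨e, he⟩ := hne
      have h1 : place ι r c q '' e ∈ E(F.image (place ι r c q)) := ⟨e, he, rfl⟩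
      exact hdet q q' _ h1 (by have := h1; rwa [show F.image (place ι r c q) = _ from heq] at this)

theorem image_congr {W α : Type*} {F : Hypergraph W} {f g : W → α} (h : Set.EqOn f g V(F)) :
    F.image f = F.image g := by
  refine Hypergraph.ext (Set.image_congr h) (Set.image_congr fun e he => ?_)
  exact Set.image_congr fun w hw => h (F.subset_vertexSet_of_mem_edgeSet' he hw)

/-- Among the maps from `F` to the union of placed copies with given part labels, only a `1 / |H|`
fraction of all choices of positions gives a homomorphism: composed with the map to the core, the
labels give an automorphism of the core, so that the relation of the obstruction applies. -/
theorem card_positions_mul_le {W K : Type*} [Field K] {H H' : Type} [AddCommGroup H]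
    [Module K H] [AddCommGroup H'] [Module K H'] [Fintype H] [Fintype H'] {v k L : ℕ}
    {F : Hypergraph W} {ι : W → Fin v} {j : Fin v → W} {r : W → W} {c : W → Fin k → K}
    {θ : Fin k → K} {μ : W → K} {U : Finset W} {A : Set H} (hr : IsCoreMap F r)
    (hfin : V(F).Finite) (hj : ∀ i, j i ∈ V(F)) (hjι : ∀ w ∈ V(F), j (ι w) = w)
    (hU : (U : Set W) = r '' V(F)) (hobs : IsObstruction (coreEdges F r) U L c θ μ)
    (hA : AverageFree L A) (l : Fin v → Fin v) (X : Finset (Fin v → H × H'))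
    (hX : ∀ x ∈ X, ∀ e ∈ E(F), (fun w => (l (ι w), x (ι w))) '' e ∈
      E(placedUnion F ι r c θ {a : H × H' | a.1 ∈ A})) :
    X.card * Fintype.card H ≤ Fintype.card (H × H') ^ v := by
  classical
  rcases X.eq_empty_or_nonempty with rfl | ⟨x₀, hx₀⟩
  · simp
  let τ : W → W := fun w => r (j (l (ι w)))
  have hτsub : τ '' V(F) ⊆ r '' V(F) := by
    rintro _ ⟨w, -, rfl⟩
    exact ⟨_, hj _, rfl⟩
  -- An edge of `F` is sent to the edge `e'` of a copy; the labels reveal `e'` up to `ι`.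
  have hlab : ∀ x ∈ X, ∀ e ∈ E(F), ∃ e' ∈ E(F), ∃ q : Fin k → H × H',
      (Fintype.linearCombination K q θ).1 ∈ A ∧
      (∀ w ∈ e, x (ι w) = Fintype.linearCombination K q (c (τ w))) ∧ τ '' e = r '' e' := by
    intro x hx e he
    obtain ⟨e', he', q, hqA, heq⟩ := hX x hx e he
    have hpt : ∀ w ∈ e, ∀ w' ∈ e', place ι r c q w' = (l (ι w), x (ι w)) →
        τ w = r w' ∧ x (ι w) = Fintype.linearCombination K q (c (τ w)) := by
      intro w _ w' hw' h
      have h1 : τ w = r w' := by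
        have : ι w' = l (ι w) := congrArg Prod.fst h
        simp only [τ, ← this, hjι w' (F.subset_vertexSet_of_mem_edgeSet' he' hw')]
      exact ⟨h1, by rw [h1]; exact (congrArg Prod.snd h).symm⟩
    refine ⟨e', he', q, hqA, fun w hw => ?_, ?_⟩
    · obtain ⟨w', hw', h⟩ : (l (ι w), x (ι w)) ∈ place ι r c q '' e' := heq ▸ ⟨w, hw, rfl⟩
      exact (hpt w hw w' hw' h).2
    · ext y
      constructor
      · rintro ⟨w, hw, rfl⟩
        obtain ⟨w', hw', h⟩ : (l (ι w), x (ι w)) ∈ place ι r c q '' e' := heq ▸ ⟨w, hw, rfl⟩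
        exact ⟨w', hw', (hpt w hw w' hw' h).1.symm⟩
      · rintro ⟨w', hw', rfl⟩
        obtain ⟨w, hw, h⟩ : place ι r c q w' ∈ (fun w => (l (ι w), x (ι w))) '' e :=
          heq ▸ ⟨w', hw', rfl⟩
        exact ⟨w, hw, (hpt w hw w' hw' h.symm).1⟩
  have hτ : IsEndo F τ := ⟨fun w _ => hr.mapsTo (hj _), fun e he => by
    obtain ⟨e', he', -, -, -, h⟩ := hlab x₀ hx₀ e he
    exact h ▸ hr.image_mem e' he'⟩
  obtain ⟨t, ht, hte⟩ := hr.exists_inverse hfin hτ hτsub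
  rw [← hU] at ht
  have htV : ∀ u ∈ U, t u ∈ V(F) := fun u hu =>
    hr.mapsTo.image_subset (hU ▸ (ht u hu).1)
  let f : (Fin v → H × H') →+ H :=
    { toFun := fun x => ∑ u ∈ U, μ u • (x (ι (t u))).1
      map_zero' := by simp
      map_add' := fun x y => by simp [smul_add, Finset.sum_add_distrib] }
  have hfX : ∀ x ∈ X, f x = 0 := by
    intro x hx
    refine hobs.relation A hA (fun u => (x (ι (t u))).1) fun e he => ?_
    obtain ⟨-, -, q, hqA, hq, -⟩ := hlab x hx _ (hte e he)
    have hfst : ∀ a : Fin k → K, Fintype.linearCombination K (fun i => (q i).1) a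
        = (Fintype.linearCombination K q a).1 := fun a => by
      simp [Fintype.linearCombination_apply, Prod.fst_sum]
    refine ⟨fun i => (q i).1, by rwa [hfst], fun u hu => ?_⟩
    have huU : u ∈ U := by
      have := he.2 hu
      rwa [← hU] at this
    rw [hfst, hq (t u) ⟨u, hu, rfl⟩, (ht u huU).2]
  have hf : Function.Surjective f := by
    intro y
    obtain ⟨u₀, hu₀, hμ⟩ := hobs.mu_ne
    refine ⟨Pi.single (ι (t u₀)) ((μ u₀)⁻¹ • y, 0), ?_⟩
    change ∑ u ∈ U, μ u • ((Pi.single (ι (t u₀)) ((μ u₀)⁻¹ • y, 0) : Fin v → H × H')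
      (ι (t u))).1 = y
    rw [Finset.sum_eq_single_of_mem u₀ hu₀, Pi.single_eq_same, smul_inv_smul₀ hμ]
    intro u hu huu
    rw [Pi.single_eq_of_ne, Prod.fst_zero, smul_zero]
    intro heq
    have h1 := congrArg j heq
    rw [hjι _ (htV u hu), hjι _ (htV u₀ hu₀)] at h1
    exact huu (by rw [← (ht u hu).2, h1, (ht u₀ hu₀).2])
  have hcount := card_filter_mem_mul_card f hf {0}
  rw [Finset.card_singleton, one_mul, Fintype.card_fun, Fintype.card_fin] at hcount
  rw [← hcount]
  refine Nat.mul_le_mul_right _ (Finset.card_le_card fun x hx => ?_)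
  simpa using hfX x hx

/-- At most a `1 / |H|` fraction of all choices of labels and positions gives a copy of `F`. -/
theorem ncard_copies_placedUnion_mul_le {W K : Type*} [Field K] {H H' : Type} [AddCommGroup H]
    [Module K H] [AddCommGroup H'] [Module K H'] [Fintype H] [Fintype H'] {v k L : ℕ}
    {F : Hypergraph W} {ι : W → Fin v} {j : Fin v → W} {r : W → W} {c : W → Fin k → K}
    {θ : Fin k → K} {μ : W → K} {U : Finset W} {A : Set H} (hr : IsCoreMap F r)
    (hfin : V(F).Finite) (hj : ∀ i, j i ∈ V(F)) (hjι : ∀ w ∈ V(F), j (ι w) = w)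
    (hU : (U : Set W) = r '' V(F)) (hobs : IsObstruction (coreEdges F r) U L c θ μ)
    (hA : AverageFree L A) :
    (copies F (placedUnion F ι r c θ {a : H × H' | a.1 ∈ A})).ncard * Fintype.card H ≤
      v ^ v * Fintype.card (H × H') ^ v := by
  classical
  set G := placedUnion F ι r c θ {a : H × H' | a.1 ∈ A} with hG
  let P : Finset ((Fin v → Fin v) × (Fin v → H × H')) := Finset.univ.filter fun g =>
    ∀ e ∈ E(F), (fun w => (g.1 (ι w), g.2 (ι w))) '' e ∈ E(G)
  have hcopies : (copies F G).ncard ≤ P.card := by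
    rw [← Set.ncard_coe_finset]
    refine (Set.ncard_le_ncard (t := (fun g : (Fin v → Fin v) × (Fin v → H × H') =>
      F.image fun w => (g.1 (ι w), g.2 (ι w))) '' P) ?_ (P.finite_toSet.image _)).trans
      (Set.ncard_image_le P.finite_toSet)
    rintro _ ⟨hsub, f, hf, rfl⟩
    refine ⟨(fun i => (f (j i)).1, fun i => (f (j i)).2), ?_, ?_⟩
    · refine Finset.mem_coe.2 (Finset.mem_filter.2 ⟨Finset.mem_univ _, fun e he => ?_⟩)
      have : (fun w => ((f (j (ι w))).1, (f (j (ι w))).2)) '' e = f '' e :=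
        Set.image_congr fun w hw => by rw [hjι w (F.subset_vertexSet_of_mem_edgeSet' he hw)]
      rw [this]
      exact hsub.2 ⟨e, he, rfl⟩
    · exact image_congr fun w hw => by simp only [hjι w hw]
  have hH : 0 < Fintype.card H := Fintype.card_pos_iff.2 ⟨0⟩
  have hfib : P.card ≤ Fintype.card (H × H') ^ v / Fintype.card H * (P.image Prod.fst).card := by
    refine Finset.card_le_mul_card_image P _ fun l _ => ?_
    rw [Nat.le_div_iff_mul_le hH, ← Finset.card_image_of_injOn (f := Prod.snd)]
    · refine card_positions_mul_le hr hfin hj hjι hU hobs hA l _ fun x hx => ?_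
      obtain ⟨g, hg, rfl⟩ := Finset.mem_image.1 hx
      obtain ⟨hgP, rfl⟩ := Finset.mem_filter.1 hg
      exact (Finset.mem_filter.1 hgP).2
    · intro g hg g' hg' h
      exact Prod.ext ((Finset.mem_filter.1 hg).2.trans (Finset.mem_filter.1 hg').2.symm) h
  have hlabels : (P.image Prod.fst).card ≤ v ^ v := by
    refine (Finset.card_le_univ _).trans ?_
    simp
  calc (copies F G).ncard * Fintype.card H
      ≤ (Fintype.card (H × H') ^ v / Fintype.card H * v ^ v) * Fintype.card H :=
        Nat.mul_le_mul_right _ (hcopies.trans (hfib.trans (Nat.mul_le_mul_left _ hlabels)))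
    _ = v ^ v * (Fintype.card (H × H') ^ v / Fintype.card H * Fintype.card H) := by ring
    _ ≤ _ := Nat.mul_le_mul_left _ (Nat.div_mul_le_self _ _)

/-! ### Failure of polynomial bounds for hypergraphs that are not `k`-partite -/

theorem exists_labelling {W : Type*} {F : Hypergraph W} (hfin : V(F).Finite)
    (hne : V(F).Nonempty) : ∃ (ι : W → Fin V(F).ncard) (j : Fin V(F).ncard → W),
      (∀ i, j i ∈ V(F)) ∧ (∀ i, ι (j i) = i) ∧ ∀ w ∈ V(F), j (ι w) = w := by
  classical
  have := hfin.to_subtype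
  have e : V(F) ≃ Fin V(F).ncard := Finite.equivFinOfCardEq (Nat.card_coe_set_eq _)
  have hpos : 0 < V(F).ncard := (Set.ncard_pos hfin).2 hne
  refine ⟨fun w => if h : w ∈ V(F) then e ⟨w, h⟩ else ⟨0, hpos⟩, fun i => e.symm i,
    fun i => (e.symm i).2, fun i => ?_, fun w hw => ?_⟩
  · simp
  · simp [hw]

/-- The number of parameters `q` with `∑ j, θ j • q j ∈ A'`. -/
theorem card_parameters {K H : Type*} [Field K] [AddCommGroup H] [Module K H] [Fintype H]
    [DecidableEq H] {k : ℕ} {θ : Fin k → K} (hθ : θ ≠ 0) (A' : Finset H) :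
    (Finset.univ.filter fun q : Fin k → H => Fintype.linearCombination K q θ ∈ A').card *
      Fintype.card H = A'.card * Fintype.card H ^ k := by
  classical
  let f : (Fin k → H) →+ H :=
    { toFun := fun q => Fintype.linearCombination K q θ
      map_zero' := by simp [Fintype.linearCombination_apply]
      map_add' := fun x y => by
        simp [Fintype.linearCombination_apply, smul_add, Finset.sum_add_distrib] }
  have hf : Function.Surjective f := by
    intro y
    obtain ⟨i, hi⟩ := Function.ne_iff.1 hθ
    refine ⟨Pi.single i ((θ i)⁻¹ • y), ?_⟩
    change Fintype.linearCombination K _ θ = y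
    rw [Fintype.linearCombination_apply, Finset.sum_eq_single_of_mem i (Finset.mem_univ i),
      Pi.single_eq_same, smul_inv_smul₀ hi]
    intro b _ hb
    rw [Pi.single_eq_of_ne hb, smul_zero]
  have := card_filter_mem_mul_card f hf A'
  rwa [Fintype.card_fun, Fintype.card_fin] at this

/-- For a prime `p` there is an `ε` of order at least `p ^ (-2)` such that, for arbitrarily large
`n`, some hypergraph on `n` vertices has `ε * n ^ k` edge-disjoint copies of `F` but at most
`n ^ v(F) / p ^ D` copies. -/
theorem le_one_of_removalHolds {W : Type*} {k : ℕ} (hk : 1 ≤ k) {F : Hypergraph W}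
    (hfin : V(F).Finite) (hne : V(F).Nonempty) (hF : F.IsUniform k) (hpart : ¬ F.IsPartite k)
    (D : ℕ) (hD : 0 < D) {p : ℕ} (hp : p.Prime) (hpL : V(F).ncard + 2 ≤ p)
    (hpE : 2 ^ V(F).ncard < p) :
    ∃ ε : ℝ, 0 < ε ∧ ε < 1 ∧
      1 / ((2 * (V(F).ncard + 2) : ℝ) ^ D * (2 * D * (V(F).ncard : ℝ) ^ k)) / (p : ℝ) ^ 2 ≤ ε ∧
      ∀ N δ, (∀ n, N ≤ n → RemovalHolds k F ε δ n) → δ * (p : ℝ) ^ D ≤ 1 := by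
  classical
  have : Fact p.Prime := ⟨hp⟩
  set v := V(F).ncard with hv
  have hvpos : 0 < v := (Set.ncard_pos hfin).2 hne
  obtain ⟨r, hr⟩ := exists_isCoreMap hfin
  obtain ⟨ι, j, hj, -, hjι⟩ := exists_labelling hfin hne
  have hι : Set.InjOn ι V(F) := fun x hx y hy h => by rw [← hjι x hx, h, hjι y hy]
  have hUfin := hfin.image r
  have hE : ∀ e ∈ coreEdges F r, e ⊆ hUfin.toFinset := fun e he => by simpa using he.2
  have hEcard : (coreEdges F r).ncard ≤ 2 ^ v := by
    rw [hv, ← Set.ncard_powerset _ hfin]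
    exact Set.ncard_le_ncard (fun e he => F.subset_vertexSet_of_mem_edgeSet' he.1)
      hfin.finite_subsets
  have hEne : E(F).Nonempty := by
    rw [Set.nonempty_iff_ne_empty]
    intro h0
    exact hpart ⟨fun _ => ⟨0, hk⟩, by simp [h0]⟩
  obtain ⟨c, θ, μ, hobs⟩ := exists_isObstruction (p := p) (L := v + 2) hk hE
    (fun e he => hF e he.1) (fun h => hpart (hr.isPartite hfin hF h)) (hEcard.trans_lt hpE)
    (by
      rw [← Set.ncard_eq_toFinset_card _ hUfin]
      exact (Set.ncard_image_le hfin).trans (by omega)) (by omega) hpL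
  have hdp : (v + 2) * (p / (v + 2)) ≤ p := Nat.mul_div_le _ _
  obtain ⟨A, hAcard, hA⟩ := exists_averageFree p D (p / (v + 2)) (v + 2) (by omega) hdp
  set d := p / (v + 2) with hd
  have hd1 : 1 ≤ d := (Nat.one_le_div_iff (by omega)).2 hpL
  have hpd : p ≤ 2 * (v + 2) * d := by
    have h1 : p < (v + 2) * (d + 1) := Nat.lt_mul_div_succ p (by omega)
    nlinarith
  have hp0 : (0 : ℝ) < p := by exact_mod_cast hp.pos
  have hv0 : (0 : ℝ) < v := by exact_mod_cast hvpos
  have hd0 : (0 : ℝ) < d := by exact_mod_cast hd1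
  have hD0 : (0 : ℝ) < D := by exact_mod_cast hD
  have hApos : (0 : ℝ) < A.card := lt_of_lt_of_le (by positivity) hAcard
  have hAle : (A.card : ℝ) ≤ (p : ℝ) ^ D := by
    have := Finset.card_le_univ A
    rw [Fintype.card_fun, Fintype.card_fin, ZMod.card] at this
    exact_mod_cast this
  refine ⟨A.card / (2 * (p : ℝ) ^ D * (v : ℝ) ^ k), by positivity, ?_, ?_, ?_⟩
  · rw [div_lt_one (by positivity)]
    have h1 : (1 : ℝ) ≤ (v : ℝ) ^ k := one_le_pow₀ (by exact_mod_cast hvpos)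
    have h2 : (0 : ℝ) < (p : ℝ) ^ D := by positivity
    nlinarith
  · -- The sphere has density at least `(d / p) ^ D / (D * d ^ 2)`, where `p / (2 * L) ≤ d ≤ p`.
    have hdle : (d : ℝ) ^ 2 ≤ (p : ℝ) ^ 2 := by
      have : d ≤ p := Nat.div_le_self _ _
      gcongr
    have hpow : (p : ℝ) ^ D ≤ (2 * (v + 2) : ℝ) ^ D * (d : ℝ) ^ D := by
      rw [← mul_pow]
      gcongr
      exact_mod_cast hpd
    have hA' : (d : ℝ) ^ D ≤ A.card * (D * d ^ 2) := (div_le_iff₀ (by positivity)).1 hAcard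
    rw [div_div, div_le_div_iff₀ (by positivity) (by positivity), one_mul]
    calc 2 * (p : ℝ) ^ D * (v : ℝ) ^ k
        ≤ 2 * ((2 * (v + 2) : ℝ) ^ D * (A.card * (D * (p : ℝ) ^ 2))) * (v : ℝ) ^ k := by
          gcongr
          refine hpow.trans ?_
          gcongr
          refine hA'.trans ?_
          gcongr
      _ = _ := by ring
  · intro N δ hrem
    let H := Fin D → ZMod p
    let H' := Fin N → ZMod p
    have hcH : Fintype.card H = p ^ D := by simp [H, ZMod.card]
    have hcH' : Fintype.card H' = p ^ N := by simp [H', ZMod.card]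
    have hcHH : Fintype.card (H × H') = p ^ D * p ^ N := by rw [Fintype.card_prod, hcH, hcH']
    have hN : N ≤ v * (p ^ D * p ^ N) := by
      have h1 : N < p ^ N := Nat.lt_pow_self hp.one_lt
      have h2 : 0 < v * p ^ D := Nat.mul_pos hvpos (pow_pos hp.pos D)
      nlinarith
    let G : Hypergraph (Fin v × (H × H')) := placedUnion F ι r c θ {a | a.1 ∈ (A : Set H)}
    have hVG : V(G).ncard = v * (p ^ D * p ^ N) := by
      change (Set.univ : Set (Fin v × (H × H'))).ncard = _
      rw [Set.ncard_univ, Nat.card_eq_fintype_card, Fintype.card_prod, Fintype.card_fin, hcHH]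
    have hcount := card_parameters (H := H × H') hobs.theta_ne (A ×ˢ Finset.univ)
    rw [Finset.card_product, Finset.card_univ, hcHH, hcH'] at hcount
    have hup := ncard_copies_placedUnion_mul_le (H := H) (H' := H') hr hfin hj hjι
      (by simp) hobs hA
    rw [hcH, hcHH] at hup
    have hmain := hrem _ hN (Fin v × (H × H')) G Set.finite_univ hVG
      (placedUnion_isUniform hF hι) (hasEdgeDisjointCopies_placedUnion hr hfin hF hι hobs.indep
        hEne (Finset.univ.filter fun q => Fintype.linearCombination (ZMod p) q θ ∈
          A ×ˢ (Finset.univ : Finset H'))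
        (fun q hq => (Finset.mem_product.1 (Finset.mem_filter.1 hq).2).1) ?_)
    · have hup' : ((copies F G).ncard : ℝ) * (p : ℝ) ^ D
          ≤ (v : ℝ) ^ v * ((p : ℝ) ^ D * (p : ℝ) ^ N) ^ v := by exact_mod_cast hup
      push_cast at hmain
      rw [← mul_pow] at hup'
      have hpos : (0 : ℝ) < (v * ((p : ℝ) ^ D * (p : ℝ) ^ N)) ^ v := by positivity
      have h3 := (mul_le_mul_of_nonneg_right hmain
        (by positivity : (0 : ℝ) ≤ (p : ℝ) ^ D)).trans hup'
      refine le_of_mul_le_mul_right ?_ hpos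
      calc _ = δ * (v * ((p : ℝ) ^ D * (p : ℝ) ^ N)) ^ v * (p : ℝ) ^ D := by ring
        _ ≤ _ := h3
        _ = _ := (one_mul _).symm
    · have hcount' : (((Finset.univ.filter fun q : Fin k → H × H' =>
          Fintype.linearCombination (ZMod p) q θ ∈ A ×ˢ (Finset.univ : Finset H')).card : ℕ) : ℝ)
          * ((p : ℝ) ^ D * (p : ℝ) ^ N)
          = A.card * (p : ℝ) ^ N * ((p : ℝ) ^ D * (p : ℝ) ^ N) ^ k := by exact_mod_cast hcount
      have hpos : (0 : ℝ) < (p : ℝ) ^ D * (p : ℝ) ^ N := by positivity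
      refine le_of_mul_le_mul_right ?_ hpos
      rw [hcount']
      push_cast
      have : (A.card : ℝ) / (2 * (p : ℝ) ^ D * (v : ℝ) ^ k)
          * ((v : ℝ) * ((p : ℝ) ^ D * (p : ℝ) ^ N)) ^ k * ((p : ℝ) ^ D * (p : ℝ) ^ N)
          = (A.card * (p : ℝ) ^ N * ((p : ℝ) ^ D * (p : ℝ) ^ N) ^ k) / 2 := by
        rw [mul_pow]
        field_simp
      rw [this]
      exact half_le_self (by positivity)

theorem not_eventuallyPolynomialRemoval {W : Type*} {k : ℕ} (hk : 1 ≤ k) {F : Hypergraph W}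
    (hfin : V(F).Finite) (hne : V(F).Nonempty) (hF : F.IsUniform k) (hpart : ¬ F.IsPartite k) :
    ¬ F.EventuallyPolynomialRemoval k := by
  rintro ⟨c, hc, C, hC⟩
  have hvpos : (0 : ℝ) < V(F).ncard := by exact_mod_cast (Set.ncard_pos hfin).2 hne
  obtain ⟨κ, hκ⟩ : ∃ κ : ℝ, κ = 1 / ((2 * (V(F).ncard + 2) : ℝ) ^ (2 * C + 1) *
    (2 * (2 * C + 1 : ℕ) * (V(F).ncard : ℝ) ^ k)) := ⟨_, rfl⟩
  have hκ0 : 0 < κ := by rw [hκ]; positivity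
  have htwo : 0 < 2 ^ V(F).ncard := by positivity
  obtain ⟨p, hpge, hp⟩ := Nat.exists_infinite_primes
    (V(F).ncard + 2 + 2 ^ V(F).ncard + ⌈1 / (c * κ ^ C)⌉₊ + 1)
  obtain ⟨ε, hε0, hε1, hκε, hrem⟩ := le_one_of_removalHolds hk hfin hne hF hpart (2 * C + 1)
    (by omega) hp (by omega) (by omega)
  rw [← hκ] at hκε
  obtain ⟨N, hN⟩ := hC ε hε0 hε1
  have hle := hrem N _ hN
  have hp0 : (0 : ℝ) < p := by exact_mod_cast hp.pos
  have hbig : 1 / (c * κ ^ C) < p := by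
    refine (Nat.le_ceil _).trans_lt ?_
    exact_mod_cast (by omega : ⌈1 / (c * κ ^ C)⌉₊ < p)
  rw [div_lt_iff₀ (by positivity)] at hbig
  refine absurd hle (not_le.2 (hbig.trans_le ?_))
  calc (p : ℝ) * (c * κ ^ C) = c * (κ / (p : ℝ) ^ 2) ^ C * (p : ℝ) ^ (2 * C + 1) := by
        rw [div_pow, ← pow_mul, pow_succ]
        field_simp
    _ ≤ _ := by gcongr

/-! ### Supersaturation for `k`-partite hypergraphs -/

theorem mean_pow_le_mean_pow {ι : Type*} [Fintype ι] [Nonempty ι] (z : ι → ℝ) (hz : ∀ i, 0 ≤ z i)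
    (n : ℕ) : ((∑ i, z i) / Fintype.card ι) ^ n ≤ (∑ i, z i ^ n) / Fintype.card ι := by
  have h := Real.pow_arith_mean_le_arith_mean_pow Finset.univ
    (fun _ : ι => (Fintype.card ι : ℝ)⁻¹) z (fun _ _ => by positivity) (by simp)
    (fun i _ => hz i) n
  rwa [← Finset.mul_sum, ← Finset.mul_sum, inv_mul_eq_div, inv_mul_eq_div] at h

/-- Erdős' inequality for complete `k`-partite hypergraphs: if the tuples with weights `f` have
average weight `δ`, then the blow-ups `x`, with `t` vertices in each of `k` parts, have average
weight at least `δ ^ (t ^ k)`. The induction on `k` applies Jensen's inequality twice: to the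
average over the vertices of the first part, and to the average over the remaining parts. -/
theorem mean_pow_le_mean_prod {X : Type*} [Fintype X] [Nonempty X] (t k : ℕ)
    (f : (Fin k → X) → ℝ) (hf : ∀ x, 0 ≤ f x) :
    ((∑ x, f x) / (Fintype.card X : ℝ) ^ k) ^ t ^ k ≤
      (∑ x : Fin k → Fin t → X, ∏ g : Fin k → Fin t, f fun i => x i (g i)) /
        ((Fintype.card X : ℝ) ^ t) ^ k := by
  classical
  have hn : (0 : ℝ) < Fintype.card X := by exact_mod_cast Fintype.card_pos
  induction k with
  | zero => simp [Subsingleton.elim _ (default : Fin 0 → X)]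
  | succ k ih =>
    let P : X → (Fin k → Fin t → X) → ℝ := fun z x => ∏ g : Fin k → Fin t,
      f (Fin.cons z fun i => x i (g i))
    have hP : ∀ z x, 0 ≤ P z x := fun z x => Finset.prod_nonneg fun _ _ => hf _
    have hsum : ∑ x, f x = ∑ z, ∑ x : Fin k → X, f (Fin.cons z x) := by
      rw [← Fintype.sum_prod_type']
      exact (Fintype.sum_equiv (Fin.consEquiv fun _ => X) _ _ fun _ => rfl).symm
    have hcount : ∑ x : Fin (k + 1) → Fin t → X, ∏ g : Fin (k + 1) → Fin t, f (fun i => x i (g i))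
        = ∑ x : Fin k → Fin t → X, (∑ z, P z x) ^ t := by
      have h1 : ∀ x : Fin k → Fin t → X, (∑ z, P z x) ^ t
          = ∑ x₀ : Fin t → X, ∏ y, P (x₀ y) x := fun x => Fintype.sum_pow _ _
      simp_rw [h1]
      rw [Finset.sum_comm, ← Fintype.sum_prod_type']
      refine (Fintype.sum_equiv (Fin.consEquiv fun _ => Fin t → X) _ _ fun x => ?_).symm
      simp only [P]
      rw [← Fintype.prod_prod_type']
      refine Fintype.prod_equiv (Fin.consEquiv fun _ => Fin t) _ _ fun g => ?_
      congr 1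
      funext i
      refine Fin.cases ?_ (fun i => ?_) i <;> simp [Fin.consEquiv]
    have hcard : ((Fintype.card (Fin k → Fin t → X) : ℕ) : ℝ) = ((Fintype.card X : ℝ) ^ t) ^ k := by
      simp
    have hmean : ∀ z, ((∑ x : Fin k → X, f (Fin.cons z x)) / (Fintype.card X : ℝ) ^ k) ^ t ^ k ≤
        (∑ x, P z x) / ((Fintype.card X : ℝ) ^ t) ^ k := fun z =>
      ih (fun x => f (Fin.cons z x)) fun _ => hf _
    rw [hsum, hcount]
    calc ((∑ z, ∑ x : Fin k → X, f (Fin.cons z x)) / (Fintype.card X : ℝ) ^ (k + 1)) ^ t ^ (k + 1)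
        = (((∑ z, (∑ x : Fin k → X, f (Fin.cons z x)) / (Fintype.card X : ℝ) ^ k) /
            Fintype.card X) ^ t ^ k) ^ t := by
          rw [← Finset.sum_div, div_div, ← pow_succ, ← pow_mul, ← pow_succ]
      _ ≤ ((∑ z, ((∑ x : Fin k → X, f (Fin.cons z x)) / (Fintype.card X : ℝ) ^ k) ^ t ^ k) /
            Fintype.card X) ^ t := by
          refine pow_le_pow_left₀ (pow_nonneg (div_nonneg (Finset.sum_nonneg fun z _ =>
            div_nonneg (Finset.sum_nonneg fun x _ => hf _) (by positivity)) hn.le) _) ?_ t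
          exact mean_pow_le_mean_pow _ (fun z => div_nonneg (Finset.sum_nonneg fun x _ => hf _)
            (by positivity)) _
      _ ≤ ((∑ z, (∑ x, P z x) / ((Fintype.card X : ℝ) ^ t) ^ k) / Fintype.card X) ^ t := by
          refine pow_le_pow_left₀ ?_ ?_ t
          · exact div_nonneg (Finset.sum_nonneg fun z _ => pow_nonneg
              (div_nonneg (Finset.sum_nonneg fun x _ => hf _) (by positivity)) _) hn.le
          · exact div_le_div_of_nonneg_right (Finset.sum_le_sum fun z _ => hmean z) hn.le
      _ = ((∑ x, ∑ z, P z x) / ((Fintype.card X : ℝ) ^ t) ^ k) ^ t / (Fintype.card X : ℝ) ^ t := by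
          rw [← div_pow, ← Finset.sum_div, Finset.sum_comm]
      _ ≤ ((∑ x, (∑ z, P z x) ^ t) / ((Fintype.card X : ℝ) ^ t) ^ k) /
            (Fintype.card X : ℝ) ^ t := by
          refine div_le_div_of_nonneg_right ?_ (by positivity)
          have := mean_pow_le_mean_pow (fun x : Fin k → Fin t → X => ∑ z, P z x)
            (fun x => Finset.sum_nonneg fun z _ => hP z x) t
          rwa [hcard] at this
      _ = _ := by rw [div_div, ← pow_succ]

/-- Each map `φ` arises from the same number of `x` as `fun i => x (χ i) i`. -/
theorem card_filter_diagonal_mul_le {X : Type*} [Fintype X] [DecidableEq X] {k v : ℕ}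
    (χ : Fin v → Fin k) (Φ : Finset (Fin v → X)) :
    (Finset.univ.filter fun x : Fin k → Fin v → X => (fun i => x (χ i) i) ∈ Φ).card *
      Fintype.card X ^ v ≤ Φ.card * (Fintype.card X ^ v) ^ k := by
  classical
  have h1 : Fintype.card X ^ v = (Finset.univ : Finset (Fin v → X)).card := by simp
  have h2 : (Fintype.card X ^ v) ^ k = (Finset.univ : Finset (Fin k → Fin v → X)).card := by simp
  rw [h2, h1, ← Finset.card_product, ← Finset.card_product]
  -- Exchange the diagonal entries of `x` for those of a second map `ψ`.
  refine Finset.card_le_card_of_injOn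
    (fun y => (fun i => y.1 (χ i) i, fun a i => if a = χ i then y.2 i else y.1 a i)) ?_ ?_
  · intro y hy
    have := (Finset.mem_filter.1 (Finset.mem_product.1 (Finset.mem_coe.1 hy)).1).2
    exact Finset.mem_coe.2 (Finset.mem_product.2 ⟨this, Finset.mem_univ _⟩)
  · rintro ⟨x, ψ⟩ - ⟨x', ψ'⟩ - h
    obtain ⟨hd, ho⟩ := Prod.mk.inj h
    refine Prod.ext (funext fun a => funext fun i => ?_) (funext fun i => ?_)
    · by_cases ha : a = χ i
      · subst ha
        exact congrFun hd i
      · simpa [ha] using congrFun (congrFun ho a) i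
    · simpa using congrFun (congrFun ho (χ i)) i

theorem card_filter_not_injective_mul_le (X : Type*) [Fintype X] [DecidableEq X] (v : ℕ) :
    (Finset.univ.filter fun φ : Fin v → X => ¬ Function.Injective φ).card * Fintype.card X ≤
      v ^ 2 * Fintype.card X ^ v := by
  classical
  have hpair : ∀ a b : Fin v, a ≠ b →
      (Finset.univ.filter fun φ : Fin v → X => φ a = φ b).card * Fintype.card X ≤
        Fintype.card X ^ v := by
    intro a b hab
    have h1 : Fintype.card X ^ v = (Finset.univ : Finset (Fin v → X)).card := by simp
    rw [h1, ← Finset.card_univ (α := X), ← Finset.card_product]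
    refine Finset.card_le_card_of_injOn (fun y => Function.update y.1 a y.2)
      (fun y _ => Finset.mem_coe.2 (Finset.mem_univ _)) ?_
    rintro ⟨φ, z⟩ hφ ⟨φ', z'⟩ hφ' h
    have hφ := (Finset.mem_filter.1 (Finset.mem_product.1 (Finset.mem_coe.1 hφ)).1).2
    have hφ' := (Finset.mem_filter.1 (Finset.mem_product.1 (Finset.mem_coe.1 hφ')).1).2
    dsimp only at hφ hφ' h
    have hoff : ∀ i, i ≠ a → φ i = φ' i := fun i hi => by
      simpa [Function.update_of_ne hi] using congrFun h i
    refine Prod.ext (funext fun i => ?_) (by simpa using congrFun h a)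
    by_cases hi : i = a
    · subst hi
      exact hφ.trans ((hoff b hab.symm).trans hφ'.symm)
    · exact hoff i hi
  have hcover : (Finset.univ.filter fun φ : Fin v → X => ¬ Function.Injective φ) ⊆
      (Finset.univ.filter fun ab : Fin v × Fin v => ab.1 ≠ ab.2).biUnion fun ab =>
        Finset.univ.filter fun φ : Fin v → X => φ ab.1 = φ ab.2 := by
    intro φ hφ
    have := (Finset.mem_filter.1 hφ).2
    simp only [Function.Injective, not_forall] at this
    obtain ⟨a, b, h, hab⟩ := this
    exact Finset.mem_biUnion.2 ⟨(a, b), by simpa using hab, by simpa using h⟩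
  calc _ ≤ (∑ ab ∈ Finset.univ.filter fun ab : Fin v × Fin v => ab.1 ≠ ab.2,
        (Finset.univ.filter fun φ : Fin v → X => φ ab.1 = φ ab.2).card) * Fintype.card X :=
        Nat.mul_le_mul_right _ ((Finset.card_le_card hcover).trans Finset.card_biUnion_le)
    _ ≤ (Finset.univ.filter fun ab : Fin v × Fin v => ab.1 ≠ ab.2).card *
        Fintype.card X ^ v := by
        rw [Finset.sum_mul, ← smul_eq_mul]
        exact Finset.sum_le_card_nsmul _ _ _ fun ab hab =>
          hpair ab.1 ab.2 (Finset.mem_filter.1 hab).2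
    _ ≤ _ := by
        refine Nat.mul_le_mul_right _ ((Finset.card_le_univ _).trans ?_)
        simp [sq]

/-- Copies with at least one edge that are pairwise edge-disjoint need as many edges. -/
theorem HasEdgeDisjointCopies.le_ncard_edgeSet {W α : Type*} {F : Hypergraph W}
    {G : Hypergraph α} {m : ℝ} (h : HasEdgeDisjointCopies F G m) (hne : E(F).Nonempty)
    (hG : V(G).Finite) : m ≤ E(G).ncard := by
  classical
  obtain ⟨𝒞, hcop, hdisj, hm⟩ := h
  have hE : E(G).Finite :=
    hG.finite_subsets.subset fun _ he => G.subset_vertexSet_of_mem_edgeSet' he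
  have hex : ∀ H ∈ 𝒞, ∃ e, e ∈ E(H) := by
    intro H hH
    obtain ⟨-, f, -, rfl⟩ := hcop H hH
    obtain ⟨e, he⟩ := hne
    exact ⟨_, e, he, rfl⟩
  choose! s hs using hex
  refine hm.trans ?_
  rw [← Set.ncard_coe_finset]
  refine Nat.cast_le.2 (Set.ncard_le_ncard_of_injOn s
    (fun H hH => (hcop H hH).1.2 (hs H hH)) ?_ hE)
  intro H hH H' hH' heq
  by_contra hne'
  exact Set.disjoint_left.1 (hdisj H hH H' hH' hne') (hs H hH) (heq ▸ hs H' hH')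

/-- The maps from labels to vertices of `G` that are homomorphisms from `F` to `G`. -/
noncomputable def homs {W α : Type*} (F : Hypergraph W) (G : Hypergraph α) {v : ℕ} (ι : W → Fin v)
    [Fintype V(G)] : Finset (Fin v → V(G)) :=
  letI := Classical.decPred fun φ : Fin v → V(G) => ∀ e ∈ E(F), (fun w => (φ (ι w)).1) '' e ∈ E(G)
  Finset.univ.filter fun φ => ∀ e ∈ E(F), (fun w => (φ (ι w)).1) '' e ∈ E(G)

theorem mem_homs {W α : Type*} {F : Hypergraph W} {G : Hypergraph α} {v : ℕ} {ι : W → Fin v}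
    [Fintype V(G)] {φ : Fin v → V(G)} :
    φ ∈ homs F G ι ↔ ∀ e ∈ E(F), (fun w => (φ (ι w)).1) '' e ∈ E(G) := by
  simp [homs]

/-- The supersaturation bound for a `k`-partite `F`, which maps to the complete `k`-partite
hypergraph with `v` vertices in each part by sending `w` to the copy `ι w` in the part of `w`. -/
theorem le_card_homs {W α : Type*} {k v : ℕ} {F : Hypergraph W} {G : Hypergraph α}
    [Fintype V(G)] [Nonempty V(G)] {ι : W → Fin v} {j : Fin v → W}
    (hjι : ∀ w ∈ V(F), j (ι w) = w) (hpart : F.IsPartite k) (hG : G.IsUniform k)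
    {ε : ℝ} (hε0 : 0 ≤ ε) (hε : ε * (Fintype.card V(G) : ℝ) ^ k ≤ E(G).ncard) :
    ε ^ v ^ k * (Fintype.card V(G) : ℝ) ^ v ≤ (homs F G ι).card := by
  classical
  obtain ⟨χ, hχ⟩ := hpart
  have hn : (0 : ℝ) < Fintype.card V(G) := by exact_mod_cast Fintype.card_pos
  let T : Finset (Fin k → V(G)) :=
    Finset.univ.filter fun x => Set.range (fun i => (x i).1) ∈ E(G)
  let f : (Fin k → V(G)) → ℝ := fun x => if x ∈ T then 1 else 0
  have hT : E(G).ncard ≤ T.card := by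
    have hex : ∀ e ∈ E(G), ∃ x : Fin k → V(G), Set.range (fun i => (x i).1) = e := by
      intro e he
      have hsub := G.subset_vertexSet_of_mem_edgeSet' he
      have := (V(G).toFinite.subset hsub).to_subtype
      let b : e ≃ Fin k := Finite.equivFinOfCardEq ((Nat.card_coe_set_eq e).trans (hG e he))
      refine ⟨fun i => ⟨b.symm i, hsub (b.symm i).2⟩, ?_⟩
      ext y
      constructor
      · rintro ⟨i, rfl⟩
        exact (b.symm i).2
      · intro hy
        exact ⟨b ⟨y, hy⟩, by simp⟩
    choose! s hs using hex
    rw [← Set.ncard_coe_finset T]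
    refine Set.ncard_le_ncard_of_injOn s (fun e he => ?_) (fun e he e' he' h => ?_) T.finite_toSet
    · exact Finset.mem_coe.2 (Finset.mem_filter.2 ⟨Finset.mem_univ _, by rwa [hs e he]⟩)
    · rw [← hs e he, h, hs e' he']
  have hsum : ∑ x, f x = T.card := by simp [f]
  have hmain := mean_pow_le_mean_prod v k f fun x => by simp only [f]; split_ifs <;> norm_num
  have hleft : ε ^ v ^ k ≤ ((∑ x, f x) / (Fintype.card V(G) : ℝ) ^ k) ^ v ^ k := by
    refine pow_le_pow_left₀ hε0 ?_ _
    rw [le_div_iff₀ (by positivity), hsum]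
    exact hε.trans (by exact_mod_cast hT)
  have hdiag : ∑ x : Fin k → Fin v → V(G), ∏ g : Fin k → Fin v, f (fun i => x i (g i)) ≤
      ((Finset.univ.filter fun x : Fin k → Fin v → V(G) =>
        (fun i => x (χ (j i)) i) ∈ homs F G ι).card : ℝ) := by
    rw [← Finset.sum_boole]
    refine Finset.sum_le_sum fun x _ => ?_
    split_ifs with hx
    · refine Finset.prod_le_one (fun g _ => ?_) fun g _ => ?_ <;>
        simp only [f] <;> split_ifs <;> norm_num
    · -- If `x` is a complete `k`-partite blow-up inside `G`, then it contains a copy of `F`.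
      refine le_of_not_gt fun hpos => hx (mem_homs.2 fun e he => ?_)
      have hinT : ∀ g : Fin k → Fin v, (fun i => x i (g i)) ∈ T := by
        intro g
        by_contra hg
        exact hpos.ne' (Finset.prod_eq_zero (Finset.mem_univ g) (by simp [f, hg]))
      choose s hs using fun i => (hχ e he).surjOn (Set.mem_univ i)
      have hmem := (Finset.mem_filter.1 (hinT fun i => ι (s i))).2
      convert hmem using 1
      ext y
      constructor
      · rintro ⟨w, hw, rfl⟩
        have hsw : s (χ w) = w := (hχ e he).injOn (hs _).1 hw (hs _).2
        refine ⟨χ w, ?_⟩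
        simp only [hsw, hjι w (F.subset_vertexSet_of_mem_edgeSet' he hw)]
      · rintro ⟨i, rfl⟩
        refine ⟨s i, (hs i).1, ?_⟩
        simp only [hjι _ (F.subset_vertexSet_of_mem_edgeSet' he (hs i).1), (hs i).2]
  have hcard : ((Finset.univ.filter fun x : Fin k → Fin v → V(G) =>
      (fun i => x (χ (j i)) i) ∈ homs F G ι).card : ℝ) * (Fintype.card V(G) : ℝ) ^ v ≤
        (homs F G ι).card * ((Fintype.card V(G) : ℝ) ^ v) ^ k := by
    exact_mod_cast card_filter_diagonal_mul_le (fun i => χ (j i)) (homs F G ι)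
  have h1 := (le_div_iff₀ (by positivity)).1 ((hleft.trans hmain).trans
    (div_le_div_of_nonneg_right hdiag (by positivity)))
  refine le_of_mul_le_mul_right ?_ (by positivity : (0 : ℝ) < ((Fintype.card V(G) : ℝ) ^ v) ^ k)
  calc _ = ε ^ v ^ k * ((Fintype.card V(G) : ℝ) ^ v) ^ k * (Fintype.card V(G) : ℝ) ^ v := by ring
    _ ≤ _ := mul_le_mul_of_nonneg_right h1 (by positivity)
    _ ≤ _ := hcard

/-- Each copy of `F` comes from at most `v ^ v` homomorphisms. -/
theorem card_injective_homs_le {W α : Type*} {v : ℕ} {F : Hypergraph W} {G : Hypergraph α}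
    [Fintype V(G)] {ι : W → Fin v} {j : Fin v → W} (hj : ∀ i, j i ∈ V(F)) (hιj : ∀ i, ι (j i) = i)
    (hjι : ∀ w ∈ V(F), j (ι w) = w) (Φ : Finset (Fin v → V(G))) (hΦ : Φ ⊆ homs F G ι)
    (hinj : ∀ φ ∈ Φ, Function.Injective φ) : Φ.card ≤ v ^ v * (copies F G).ncard := by
  classical
  let im : (Fin v → V(G)) → Hypergraph α := fun φ => F.image fun w => (φ (ι w)).1
  have hfib : Φ.card ≤ v ^ v * (Φ.image im).card := by
    refine Finset.card_le_mul_card_image Φ _ fun H hH => ?_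
    obtain ⟨φ₀, -, rfl⟩ := Finset.mem_image.1 hH
    refine (Finset.card_le_card (t := Fintype.piFinset fun _ => Finset.univ.image φ₀) ?_).trans ?_
    · intro φ hφ
      refine Fintype.mem_piFinset.2 fun i => ?_
      have himage : V(im φ) = V(im φ₀) := by rw [(Finset.mem_filter.1 hφ).2]
      have hmem : (φ (ι (j i))).1 ∈ V(im φ₀) := himage ▸ ⟨j i, hj i, rfl⟩
      obtain ⟨w, -, hw⟩ := hmem
      rw [hιj] at hw
      exact Finset.mem_image.2 ⟨ι w, Finset.mem_univ _, Subtype.ext hw⟩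
    · rw [Fintype.card_piFinset, Finset.prod_const, Finset.card_univ, Fintype.card_fin]
      refine Nat.pow_le_pow_left (Finset.card_image_le.trans ?_) v
      simp
  refine hfib.trans (Nat.mul_le_mul_left _ ?_)
  rw [← Set.ncard_coe_finset]
  refine Set.ncard_le_ncard (fun H hH => ?_) (copies_finite F G V(G).toFinite)
  obtain ⟨φ, hφ, rfl⟩ := Finset.mem_image.1 (Finset.mem_coe.1 hH)
  refine ⟨⟨?_, ?_⟩, _, ?_, rfl⟩
  · rintro _ ⟨w, -, rfl⟩
    exact (φ (ι w)).2
  · rintro _ ⟨e, he, rfl⟩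
    exact mem_homs.1 (hΦ hφ) e he
  · intro x hx y hy h
    have := hinj φ hφ (Subtype.ext h)
    rw [← hjι x hx, this, hjι y hy]

theorem polynomialRemoval_of_isPartite {W : Type*} {k : ℕ} {F : Hypergraph W}
    (hfin : V(F).Finite) (hne : V(F).Nonempty) (hpart : F.IsPartite k) :
    F.PolynomialRemoval k := by
  classical
  have hlab := exists_labelling hfin hne
  have hv1 : 1 ≤ V(F).ncard := (Set.ncard_pos hfin).2 hne
  obtain ⟨v, hv⟩ : ∃ v, V(F).ncard = v := ⟨_, rfl⟩
  rw [hv] at hlab hv1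
  obtain ⟨ι, j, hj, hιj, hjι⟩ := hlab
  have hv0 : (0 : ℝ) < v := by exact_mod_cast hv1
  have hv1' : (1 : ℝ) ≤ v := by exact_mod_cast hv1
  refine ⟨1 / (2 * (v : ℝ) ^ 2) ^ v, by positivity, v ^ k * v,
    fun ε hε0 hε1 n α G hVG hn hG hcop => ?_⟩
  rw [hv]
  rcases Nat.eq_zero_or_pos n with rfl | hnpos
  · rw [Nat.cast_zero, zero_pow (by omega), mul_zero]
    exact Nat.cast_nonneg _
  have hn0 : (0 : ℝ) < n := by exact_mod_cast hnpos
  have hεT : 0 < ε ^ v ^ k := by positivity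
  have hone : 1 ≤ (copies F G).ncard := by
    obtain ⟨𝒞, h𝒞, -, hcard⟩ := hcop
    have : (0 : ℝ) < 𝒞.card := lt_of_lt_of_le (by positivity) hcard
    obtain ⟨H, hH⟩ := Finset.card_pos.1 (by exact_mod_cast this)
    exact (Set.ncard_pos (copies_finite F G hVG)).2 ⟨H, h𝒞 H hH⟩
  -- On few vertices, the single copy that exists is enough.
  rcases le_total (n * ε ^ v ^ k) (2 * (v : ℝ) ^ 2) with hsmall | hlarge
  · have h1 : (n * ε ^ v ^ k) ^ v ≤ (2 * (v : ℝ) ^ 2) ^ v :=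
      pow_le_pow_left₀ (by positivity) hsmall v
    calc 1 / (2 * (v : ℝ) ^ 2) ^ v * ε ^ (v ^ k * v) * (n : ℝ) ^ v
        = (n * ε ^ v ^ k) ^ v / (2 * (v : ℝ) ^ 2) ^ v := by
          rw [pow_mul, mul_pow]
          ring
      _ ≤ 1 := (div_le_one (by positivity)).2 h1
      _ ≤ _ := by exact_mod_cast hone
  have := hVG.fintype
  have hnX : Fintype.card V(G) = n := by rw [← hn, Set.ncard_eq_toFinset_card', Set.toFinset_card]
  have : Nonempty V(G) := Fintype.card_pos_iff.1 (by omega)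
  have hhoms : ε ^ v ^ k * (n : ℝ) ^ v ≤ (homs F G ι).card := by
    rcases E(F).eq_empty_or_nonempty with hE | hE
    · have : (homs F G ι).card = n ^ v := by
        rw [Finset.eq_univ_iff_forall.2 fun φ => mem_homs.2 (by simp [hE]), Finset.card_univ]
        simp [hnX]
      rw [this]
      push_cast
      exact mul_le_of_le_one_left (by positivity) (pow_le_one₀ hε0.le hε1.le)
    · rw [← hnX] at hcop ⊢
      exact le_card_homs hjι hpart hG hε0.le (hcop.le_ncard_edgeSet hE hVG)
  let I := (homs F G ι).filter Function.Injective
  have hI := card_injective_homs_le hj hιj hjι I (Finset.filter_subset _ _)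
    fun φ hφ => (Finset.mem_filter.1 hφ).2
  have hsplit : (homs F G ι).card ≤ I.card +
      (Finset.univ.filter fun φ : Fin v → V(G) => ¬ Function.Injective φ).card := by
    rw [← Finset.card_filter_add_card_filter_not (s := homs F G ι) Function.Injective]
    exact Nat.add_le_add_left (Finset.card_le_card (Finset.filter_subset_filter _
      (Finset.subset_univ _))) _
  have hnoninj := card_filter_not_injective_mul_le V(G) v
  rw [hnX] at hnoninj
  set m := (Finset.univ.filter fun φ : Fin v → V(G) => ¬ Function.Injective φ).card
  have hnoninj' : (m : ℝ) * n ≤ (v : ℝ) ^ 2 * (n : ℝ) ^ v := by exact_mod_cast hnoninj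
  have hsplit' : ((homs F G ι).card : ℝ) ≤ I.card + m := by exact_mod_cast hsplit
  have hI' : (I.card : ℝ) ≤ (v : ℝ) ^ v * (copies F G).ncard := by exact_mod_cast hI
  have hm : (m : ℝ) ≤ ε ^ v ^ k * (n : ℝ) ^ v / 2 := by
    refine le_of_mul_le_mul_right ?_ hn0
    have hnv : (0 : ℝ) < (n : ℝ) ^ v := by positivity
    nlinarith
  have hcopies : ε ^ v ^ k * (n : ℝ) ^ v ≤ 2 * (v : ℝ) ^ v * (copies F G).ncard := by linarith
  have hc : 2 * (v : ℝ) ^ v ≤ (2 * (v : ℝ) ^ 2) ^ v := by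
    rw [mul_pow]
    gcongr
    · exact le_self_pow₀ one_le_two (by omega)
    · exact le_self_pow₀ hv1' two_ne_zero
  have hpow : ε ^ (v ^ k * v) ≤ ε ^ v ^ k :=
    pow_le_pow_of_le_one hε0.le hε1.le (Nat.le_mul_of_pos_right _ hv1)
  calc 1 / (2 * (v : ℝ) ^ 2) ^ v * ε ^ (v ^ k * v) * (n : ℝ) ^ v
      ≤ 1 / (2 * (v : ℝ) ^ v) * ε ^ v ^ k * (n : ℝ) ^ v := by gcongr
    _ = ε ^ v ^ k * (n : ℝ) ^ v / (2 * (v : ℝ) ^ v) := by ring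
    _ ≤ _ := by
      rw [div_le_iff₀ (by positivity)]
      linarith

theorem PolynomialRemoval.eventually {W : Type*} {k : ℕ} {F : Hypergraph W}
    (h : F.PolynomialRemoval k) : F.EventuallyPolynomialRemoval k := by
  obtain ⟨c, hc, C, hC⟩ := h
  exact ⟨c, hc, C, fun ε h0 h1 => ⟨0, fun n _ => hC ε h0 h1 n⟩⟩

end Hypergraph

theorem theorem1 {W : Type*} (k : ℕ) (hk : 1 ≤ k) (F : Hypergraph W) (hfin : V(F).Finite)
    (hne : V(F).Nonempty) (hF : F.IsUniform k) :
    (F.PolynomialRemoval k ↔ F.IsPartite k) ∧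
      (F.EventuallyPolynomialRemoval k ↔ F.IsPartite k) := by
  have h₁ : F.IsPartite k → F.PolynomialRemoval k :=
    Hypergraph.polynomialRemoval_of_isPartite hfin hne
  have h₂ : F.EventuallyPolynomialRemoval k → F.IsPartite k := fun h => by
    by_contra hpart
    exact Hypergraph.not_eventuallyPolynomialRemoval hk hfin hne hF hpart h
  exact ⟨⟨fun h => h₂ h.eventually, h₁⟩, ⟨h₂, fun h => (h₁ h).eventually⟩⟩
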